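/- Theorem (Oberschelp Interpolation). Work in classical first-order logic with equality (with truth value constants $\top,\bot$ and nonempty structures). An occurrence of an atom in a formula is positive (negative) if it is in the scope of an even (odd) number of possibly implicit negations. For a formula $F$ let $\mathrm{Pred}^{\pm}(F)$ be the set of all pairs $+p$ ($-p$) such that the predicate $p$, other than equality, has a positive (negative) occurrence in $F$; let $\mathrm{Var}(F)$ be the set of its free individual variables, $\mathrm{Fun}(F)$ the set of function symbols occurring in it, where constants count as $0$-ary function symbols, and $\mathrm{Const}(F) \subseteq \mathrm{Fun}(F)$ the set of constants occurring in it. $F \models G$ means that every structure and variable assignment satisfying $F$ satisfy $G$. Let $F, G$ be formulas of first-order logic with equality such that $F \models G$. Then there exists a formula $H$ of first-order logic with equality such that (1) $F \models H$ and $H \models G$; (2) $\mathrm{Pred}^{\pm}(H) \subseteq \mathrm{Pred}^{\pm}(F) \cap \mathrm{Pred}^{\pm}(G)$, $\mathrm{Var}(H) \subseteq \mathrm{Var}(F) \cap \mathrm{Var}(G)$, and $\mathrm{Const}(H) \subseteq \mathrm{Const}(F) \cap \mathrm{Const}(G)$; (3) $\mathrm{Fun}(H) \subseteq \mathrm{Fun}(F)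 \cup \mathrm{Fun}(G)$; (4) if $=$ occurs positively in $H$, then $=$ occurs positively in $F$; and if $=$ occurs negatively in $H$, then $=$ occurs negatively in $G$. -/

import Mathlib

namespace Interpolation

universe u v w

/-- The function symbols that occur in a term, with their arities; constants are the function
symbols of arity `0`. -/
def termFuns {L : FirstOrder.Language.{u, v}} {β : Type w} : L.Term β → Set (Σ n, L.Functions n)
  | .var _ => ∅
  | .func f ts => {⟨_, f⟩} ∪ ⋃ i, termFuns (ts i)

/-- The function symbols (including constants) that occur in a formula. -/
def funs {L : FirstOrder.Language.{u, v}} {α : Type w} :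
    {n : ℕ} → L.BoundedFormula α n → Set (Σ k, L.Functions k)
  | _, .falsum => ∅
  | _, .equal s t => termFuns s ∪ termFuns t
  | _, .rel _ ts => ⋃ i, termFuns (ts i)
  | _, .imp φ ψ => funs φ ∪ funs ψ
  | _, .all φ => funs φ

/-- The constants that occur in a formula. -/
def consts {L : FirstOrder.Language.{u, v}} {α : Type w} {n : ℕ} (φ : L.BoundedFormula α n) :
    Set L.Constants :=
  {c | (⟨0, c⟩ : Σ k, L.Functions k) ∈ funs φ}

/-- The polarity-predicate pairs of a formula: `(true, p)` (resp. `(false, p)`) is a member iff the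
predicate `p` has an occurrence of positive (resp. negative) polarity. The left side of an
implication is in the scope of an implicit negation. Equality is not a predicate symbol of `L` and
is not listed. -/
def preds {L : FirstOrder.Language.{u, v}} {α : Type w} :
    {n : ℕ} → L.BoundedFormula α n → Set (Bool × Σ k, L.Relations k)
  | _, .falsum => ∅
  | _, .equal _ _ => ∅
  | _, .rel R _ => {(true, ⟨_, R⟩)}
  | _, .imp φ ψ => {q | (!q.1, q.2) ∈ preds φ} ∪ preds ψ
  | _, .all φ => preds φ

/-- `EqOccurs true φ` (resp. `EqOccurs false φ`): the equality sign has an occurrence of positive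
(resp. negative) polarity in `φ`. -/
def EqOccurs {L : FirstOrder.Language.{u, v}} {α : Type w} :
    {n : ℕ} → Bool → L.BoundedFormula α n → Prop
  | _, _, .falsum => False
  | _, b, .equal _ _ => b = true
  | _, _, .rel _ _ => False
  | _, b, .imp φ ψ => EqOccurs (!b) φ ∨ EqOccurs b ψ
  | _, b, .all φ => EqOccurs b φ

end Interpolation

/-! An interpolant is a formula of admitted polarities that separates `F`, taken as true, from `G`,
taken as false. The proof assumes that there is none and builds a structure satisfying `F` but not
`G`. It works with finite inseparable pairs of sets of signed formulas, ordered by extension. Every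
propositional or quantifier decomposition can be carried out in some inseparable extension
(`Condition.exists_resolved`), because separators of the decomposed pairs would combine into one of
the original pair. With countably many function symbols, a sufficiently generic ideal of such pairs
is fully decomposed (`exists_generic`).

The model consists of terms, two of them identified when their equation follows from `A ∧ B`, where
`A` and `B` are consequences of the two sides built from admitted positive equations. The truth
lemma `realize_of_mem` holds because clashing literals always produce a separator. Literals on one
side give `¬B` (`Separable.of_ne`, `Separable.of_rel_same`). Atoms on opposite sides give `A ∧ (B →
R s)` (`Separable.of_rel_cross`). Equality is positive there only through `A` and negative only
through `B`. Each of these contains equations only if its own side has positive ones, and positive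
on the side of false `G` means negative in `G`. This yields the condition on equality.

For the general case, only the finitely many non-constant function symbols of `F` and `G` are kept,
and constants are turned into variables. Unshared variables of the interpolant can be quantified
away (`exists_interpolant_shared`), which treats unshared constants too. Function symbols of
positive arity are left alone, hence the union rather than the intersection for them. -/

namespace Interpolation

open FirstOrder FirstOrder.Language

universe u v w u' w' x

/-! ### Polarities of occurrences under syntactic operations -/

section Occurrences

variable {L : FirstOrder.Language.{u, v}} {α : Type w} {β : Type w'} {n : ℕ}

@[simp] theorem preds_bot : preds (⊥ : L.BoundedFormula α n) = ∅ := rfl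

@[simp] theorem preds_not (φ : L.BoundedFormula α n) :
    preds φ.not = {q | (!q.1, q.2) ∈ preds φ} := by
  ext q; simp [preds]

@[simp] theorem preds_imp (φ ψ : L.BoundedFormula α n) :
    preds (φ.imp ψ) = {q | (!q.1, q.2) ∈ preds φ} ∪ preds ψ := rfl

@[simp] theorem preds_inf (φ ψ : L.BoundedFormula α n) :
    preds (φ ⊓ ψ) = preds φ ∪ preds ψ := by
  ext q; simp [min, preds]

@[simp] theorem preds_sup (φ ψ : L.BoundedFormula α n) :
    preds (φ ⊔ ψ) = preds φ ∪ preds ψ := by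
  ext q; simp [max]

@[simp] theorem preds_all (φ : L.BoundedFormula α (n + 1)) : preds φ.all = preds φ := rfl

@[simp] theorem preds_ex (φ : L.BoundedFormula α (n + 1)) : preds φ.ex = preds φ := by
  ext q; simp [BoundedFormula.ex]

@[simp] theorem eqOccurs_bot (b : Bool) : ¬ EqOccurs b (⊥ : L.BoundedFormula α n) := id

@[simp] theorem eqOccurs_imp (b : Bool) (φ ψ : L.BoundedFormula α n) :
    EqOccurs b (φ.imp ψ) ↔ EqOccurs (!b) φ ∨ EqOccurs b ψ := Iff.rfl

@[simp] theorem eqOccurs_not (b : Bool) (φ : L.BoundedFormula α n) :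
    EqOccurs b φ.not ↔ EqOccurs (!b) φ := by
  simp [BoundedFormula.not]

@[simp] theorem eqOccurs_inf (b : Bool) (φ ψ : L.BoundedFormula α n) :
    EqOccurs b (φ ⊓ ψ) ↔ EqOccurs b φ ∨ EqOccurs b ψ := by
  simp [min]

@[simp] theorem eqOccurs_sup (b : Bool) (φ ψ : L.BoundedFormula α n) :
    EqOccurs b (φ ⊔ ψ) ↔ EqOccurs b φ ∨ EqOccurs b ψ := by
  simp [max]

@[simp] theorem eqOccurs_all (b : Bool) (φ : L.BoundedFormula α (n + 1)) :
    EqOccurs b φ.all ↔ EqOccurs b φ := Iff.rfl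

@[simp] theorem eqOccurs_ex (b : Bool) (φ : L.BoundedFormula α (n + 1)) :
    EqOccurs b φ.ex ↔ EqOccurs b φ := by
  simp [BoundedFormula.ex]

@[simp] theorem preds_castLE {m n : ℕ} (h : m ≤ n) (φ : L.BoundedFormula α m) :
    preds (φ.castLE h) = preds φ := by
  induction φ generalizing n with
  | falsum | equal | rel => rfl
  | imp _ _ ih₁ ih₂ => simp [ih₁, ih₂]
  | all _ ih => simp [ih]

@[simp] theorem eqOccurs_castLE (b : Bool) {m n : ℕ} (h : m ≤ n) (φ : L.BoundedFormula α m) :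
    EqOccurs b (φ.castLE h) ↔ EqOccurs b φ := by
  induction φ generalizing n b with
  | falsum | equal | rel => rfl
  | imp _ _ ih₁ ih₂ => simp [ih₁, ih₂]
  | all _ ih => simp [ih]

/-- The language with the relation symbols of `L` and the function symbols `Fn`. -/
abbrev withFuns (L : FirstOrder.Language.{u, v}) (Fn : ℕ → Type u') :
    FirstOrder.Language.{u', v} :=
  ⟨Fn, L.Relations⟩

/-- Relabelling, substitution and the later change of function symbols are all term maps of this
shape, which leave relation symbols in place. -/
theorem preds_mapTermRel {Fn : ℕ → Type u'} {g : ℕ → ℕ}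
    (ft : ∀ n, L.Term (α ⊕ Fin n) → (withFuns L Fn).Term (β ⊕ Fin (g n)))
    (h : ∀ n, (withFuns L Fn).BoundedFormula β (g (n + 1)) →
      (withFuns L Fn).BoundedFormula β (g n + 1))
    (hh : ∀ n φ, preds (h n φ) = preds φ) (φ : L.BoundedFormula α n) :
    preds (φ.mapTermRel ft (fun _ => id) h) = preds φ := by
  induction φ with
  | falsum | equal | rel => rfl
  | imp _ _ ih₁ ih₂ => rw [BoundedFormula.mapTermRel, preds, ih₁, ih₂, preds]
  | all _ ih => rw [BoundedFormula.mapTermRel, preds, hh, ih, preds]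

theorem eqOccurs_mapTermRel {Fn : ℕ → Type u'} {g : ℕ → ℕ}
    (ft : ∀ n, L.Term (α ⊕ Fin n) → (withFuns L Fn).Term (β ⊕ Fin (g n)))
    (h : ∀ n, (withFuns L Fn).BoundedFormula β (g (n + 1)) →
      (withFuns L Fn).BoundedFormula β (g n + 1))
    (hh : ∀ b n φ, EqOccurs b (h n φ) ↔ EqOccurs b φ) (b : Bool) (φ : L.BoundedFormula α n) :
    EqOccurs b (φ.mapTermRel ft (fun _ => id) h) ↔ EqOccurs b φ := by
  induction φ generalizing b with
  | falsum | equal | rel => rfl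
  | imp _ _ ih₁ ih₂ => rw [BoundedFormula.mapTermRel, EqOccurs, ih₁, ih₂, EqOccurs]
  | all _ ih => rw [BoundedFormula.mapTermRel, EqOccurs, hh, ih, EqOccurs]

@[simp] theorem preds_relabel {k : ℕ} (g : α → β ⊕ Fin n) (φ : L.BoundedFormula α k) :
    preds (φ.relabel g) = preds φ :=
  preds_mapTermRel (Fn := L.Functions) _ _ (fun _ _ => preds_castLE _ _) φ

@[simp] theorem eqOccurs_relabel (b : Bool) {k : ℕ} (g : α → β ⊕ Fin n)
    (φ : L.BoundedFormula α k) : EqOccurs b (φ.relabel g) ↔ EqOccurs b φ :=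
  eqOccurs_mapTermRel (Fn := L.Functions) _ _ (fun _ _ _ => eqOccurs_castLE _ _ _) b φ

@[simp] theorem preds_subst (φ : L.BoundedFormula α n) (d : α → L.Term β) :
    preds (φ.subst d) = preds φ :=
  preds_mapTermRel (Fn := L.Functions) (g := id)
    (fun _ t => t.subst (Sum.elim (Term.relabel Sum.inl ∘ d) (var ∘ Sum.inr)))
    (fun _ => id) (fun _ _ => rfl) φ

@[simp] theorem eqOccurs_subst (b : Bool) (φ : L.BoundedFormula α n) (d : α → L.Term β) :
    EqOccurs b (φ.subst d) ↔ EqOccurs b φ :=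
  eqOccurs_mapTermRel (Fn := L.Functions) (g := id)
    (fun _ t => t.subst (Sum.elim (Term.relabel Sum.inl ∘ d) (var ∘ Sum.inr)))
    (fun _ => id) (fun _ _ _ => Iff.rfl) b φ

@[simp] theorem preds_restrictFreeVar [DecidableEq α] (φ : L.BoundedFormula α n)
    (f : φ.freeVarFinset → β) : preds (φ.restrictFreeVar f) = preds φ := by
  induction φ with
  | falsum | equal | rel => rfl
  | imp _ _ ih₁ ih₂ => simp [BoundedFormula.restrictFreeVar, ih₁, ih₂]
  | all _ ih => exact ih f

@[simp] theorem eqOccurs_restrictFreeVar [DecidableEq α] (b : Bool) (φ : L.BoundedFormula α n)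
    (f : φ.freeVarFinset → β) : EqOccurs b (φ.restrictFreeVar f) ↔ EqOccurs b φ := by
  induction φ generalizing b with
  | falsum | equal | rel => rfl
  | imp _ _ ih₁ ih₂ => simp [BoundedFormula.restrictFreeVar, ih₁, ih₂]
  | all _ ih => exact ih b f

@[simp] theorem preds_exs (φ : L.BoundedFormula α n) : preds φ.exs = preds φ := by
  induction n with
  | zero => rfl
  | succ n ih => rw [BoundedFormula.exs, ih, preds_ex]

@[simp] theorem eqOccurs_exs (b : Bool) (φ : L.BoundedFormula α n) :
    EqOccurs b φ.exs ↔ EqOccurs b φ := by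
  induction n with
  | zero => rfl
  | succ n ih => rw [BoundedFormula.exs, ih, eqOccurs_ex]

@[simp] theorem preds_alls (φ : L.BoundedFormula α n) : preds φ.alls = preds φ := by
  induction n with
  | zero => rfl
  | succ n ih => rw [BoundedFormula.alls, ih, preds_all]

@[simp] theorem eqOccurs_alls (b : Bool) (φ : L.BoundedFormula α n) :
    EqOccurs b φ.alls ↔ EqOccurs b φ := by
  induction n with
  | zero => rfl
  | succ n ih => rw [BoundedFormula.alls, ih, eqOccurs_all]

@[simp] theorem preds_iExs [Finite β] (φ : L.Formula (α ⊕ β)) : preds (φ.iExs β) = preds φ := by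
  simp [Formula.iExs]

@[simp] theorem eqOccurs_iExs [Finite β] (b : Bool) (φ : L.Formula (α ⊕ β)) :
    EqOccurs b (φ.iExs β) ↔ EqOccurs b φ := by
  simp [Formula.iExs]

@[simp] theorem preds_iAlls [Finite β] (φ : L.Formula (α ⊕ β)) :
    preds (φ.iAlls β) = preds φ := by
  simp [Formula.iAlls]

@[simp] theorem eqOccurs_iAlls [Finite β] (b : Bool) (φ : L.Formula (α ⊕ β)) :
    EqOccurs b (φ.iAlls β) ↔ EqOccurs b φ := by
  simp [Formula.iAlls]

theorem realize_term_congr {M : Type*} [L.Structure M] [DecidableEq α] {t : L.Term (α ⊕ β)}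
    {v v' : α → M} {x : β → M} (h : ∀ a ∈ t.varFinsetLeft, v a = v' a) :
    t.realize (Sum.elim v x) = t.realize (Sum.elim v' x) := by
  induction t with
  | var a => rcases a with a | a <;> simp_all
  | func f ts ih =>
    simp only [Term.realize]
    congr 1; funext i
    exact ih i fun a ha => h a (by simpa using ⟨i, ha⟩)

theorem realize_congr {M : Type*} [L.Structure M] [DecidableEq α] {φ : L.BoundedFormula α n}
    {v v' : α → M} {x : Fin n → M} (h : ∀ a ∈ φ.freeVarFinset, v a = v' a) :
    φ.Realize v x ↔ φ.Realize v' x := by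
  induction φ with
  | falsum => rfl
  | equal s t =>
    simp only [BoundedFormula.Realize]
    rw [realize_term_congr (t := s) fun a ha => h a (by simp [ha]),
      realize_term_congr (t := t) fun a ha => h a (by simp [ha])]
  | rel R ts =>
    simp only [BoundedFormula.Realize]
    refine iff_of_eq (congrArg _ (funext fun i => realize_term_congr fun a ha => h a ?_))
    simpa using ⟨i, ha⟩
  | imp φ ψ ih₁ ih₂ =>
    simp only [BoundedFormula.Realize]
    rw [ih₁ fun a ha => h a (by simp [ha]), ih₂ fun a ha => h a (by simp [ha])]
  | all φ ih => exact forall_congr' fun m => ih h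

end Occurrences

/-! ### Separation of two sets of signed formulas -/

section Separation

variable {L : FirstOrder.Language.{u, v}}

/-- Existential quantification over the free variable `i`. -/
def exVar (i : ℕ) (φ : L.Formula ℕ) : L.Formula ℕ :=
  (BoundedFormula.relabel (n := 1) (fun k => if k = i then Sum.inr 0 else Sum.inl k) φ :
    L.BoundedFormula ℕ 1).ex

theorem realize_exVar {M : Type*} [L.Structure M] {i : ℕ} {φ : L.Formula ℕ} {v : ℕ → M} :
    (exVar i φ).Realize v ↔ ∃ m, φ.Realize (Function.update v i m) := by
  rw [exVar, Formula.Realize, BoundedFormula.realize_ex]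
  refine exists_congr fun m => ?_
  rw [BoundedFormula.realize_relabel, Formula.Realize]
  refine iff_of_eq (congrArg₂ _ (funext fun k => ?_) (Subsingleton.elim _ _))
  by_cases hk : k = i
  · subst hk; simp [Fin.snoc]
  · simp [hk]

/-- A formula with bound variables evaluated at terms, together with a truth value. -/
structure SignedFormula (L : FirstOrder.Language.{u, v}) where
  /-- The truth value. -/
  sign : Bool
  /-- The number of bound variables. -/
  {arity : ℕ}
  /-- The formula. -/
  formula : L.BoundedFormula ℕ arity
  /-- The terms that replace the bound variables. -/
  args : Fin arity → L.Term ℕ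

/-- The signed formula has its prescribed truth value under the assignment `v`. -/
def SignedFormula.Holds (c : SignedFormula L) {M : Type*} [L.Structure M] (v : ℕ → M) : Prop :=
  c.formula.Realize v (fun i => (c.args i).realize v) ↔ c.sign = true

/-- The polarities in which relation symbols and equality may occur. -/
structure Polarity (L : FirstOrder.Language.{u, v}) where
  /-- The admitted signed relation symbols. -/
  rel : Set (Bool × Σ k, L.Relations k)
  /-- Whether positive occurrences of equality are admitted. -/
  eq : Prop

/-- The relation symbols and positive equalities of `c` are admitted by `P`. -/
def SignedFormula.Within (c : SignedFormula L) (P : Polarity L) : Prop :=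
  (∀ b p, (b, p) ∈ preds c.formula → (b == c.sign, p) ∈ P.rel) ∧
    (EqOccurs c.sign c.formula → P.eq)

/-- `H` may separate a theory with polarities `P` from a theory with polarities `Q`. -/
def Admits (P Q : Polarity L) (H : L.Formula ℕ) : Prop :=
  (∀ b p, (b, p) ∈ preds H → (b, p) ∈ P.rel ∧ (!b, p) ∈ Q.rel) ∧
    (EqOccurs true H → P.eq) ∧ (EqOccurs false H → Q.eq)

/-- `A` holds in all models of `Γ`. -/
def Entails (Γ : Set (SignedFormula L)) (A : L.Formula ℕ) : Prop :=
  ∀ (M : Type x) [L.Structure M] (v : ℕ → M), (∀ c ∈ Γ, c.Holds v) → A.Realize v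

/-- An admitted formula separates `Γ` from `Δ`. -/
def Separable (P Q : Polarity L) (Γ Δ : Set (SignedFormula L)) : Prop :=
  ∃ H, Admits P Q H ∧ Entails.{u, v, x} Γ H ∧ Entails.{u, v, x} Δ H.not

variable {P Q : Polarity L} {Γ Γ' Δ Δ' : Set (SignedFormula L)}

theorem Entails.mono {A : L.Formula ℕ} (h : Entails.{u, v, x} Γ A) (hΓ : Γ ⊆ Γ') :
    Entails.{u, v, x} Γ' A :=
  fun M _ v hv => h M v fun c hc => hv c (hΓ hc)

theorem Admits.not {H : L.Formula ℕ} (h : Admits P Q H) : Admits Q P H.not := by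
  refine ⟨fun b p hp => ?_, fun he => h.2.2 (by simpa using he), fun he => h.2.1 (by simpa using he)⟩
  have := h.1 (!b) p (by simpa using hp)
  exact ⟨by simpa using this.2, this.1⟩

/-- Negating the separator exchanges both the two sides and the polarities. Hence each decomposition
rule is needed for the first side only. -/
theorem Separable.symm (h : Separable.{u, v, x} P Q Γ Δ) : Separable.{u, v, x} Q P Δ Γ := by
  obtain ⟨H, h₁, h₂, h₃⟩ := h
  exact ⟨H.not, h₁.not, h₃, fun M _ v hv => by simpa using h₂ M v hv⟩

theorem Separable.of_entails (h : Separable.{u, v, x} P Q Γ' Δ)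
    (hΓ : ∀ (M : Type x) [L.Structure M] (v : ℕ → M), (∀ c ∈ Γ, c.Holds v) → ∀ c ∈ Γ', c.Holds v) :
    Separable.{u, v, x} P Q Γ Δ := by
  obtain ⟨H, h₁, h₂, h₃⟩ := h
  exact ⟨H, h₁, fun M _ v hv => h₂ M v (hΓ M v hv), h₃⟩

theorem Separable.of_unsat
    (hΓ : ∀ (M : Type x) [L.Structure M] (v : ℕ → M), ¬ ∀ c ∈ Γ, c.Holds v) :
    Separable.{u, v, x} P Q Γ Δ :=
  ⟨⊥, by simp [Admits], fun M _ v hv => (hΓ M v hv).elim, fun M _ v _ => by simp⟩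

/-- The disjunction of the two separators works. This is the branching rule. -/
theorem Separable.or {c₁ c₂ : SignedFormula L} (h₁ : Separable.{u, v, x} P Q (insert c₁ Γ) Δ)
    (h₂ : Separable.{u, v, x} P Q (insert c₂ Γ) Δ)
    (hΓ : ∀ (M : Type x) [L.Structure M] (v : ℕ → M), (∀ c ∈ Γ, c.Holds v) →
      c₁.Holds v ∨ c₂.Holds v) : Separable.{u, v, x} P Q Γ Δ := by
  obtain ⟨H₁, a₁, b₁, d₁⟩ := h₁
  obtain ⟨H₂, a₂, b₂, d₂⟩ := h₂
  refine ⟨H₁ ⊔ H₂, ⟨fun b p hp => ?_, fun he => ?_, fun he => ?_⟩, fun M _ v hv => ?_,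
    fun M _ v hv => ?_⟩
  · rw [preds_sup] at hp
    exact hp.elim (a₁.1 b p) (a₂.1 b p)
  · rw [eqOccurs_sup] at he
    exact he.elim a₁.2.1 a₂.2.1
  · rw [eqOccurs_sup] at he
    exact he.elim a₁.2.2 a₂.2.2
  · rw [Formula.realize_sup]
    exact (hΓ M v hv).imp (fun h => b₁ M v (Set.forall_mem_insert.2 ⟨h, hv⟩))
      (fun h => b₂ M v (Set.forall_mem_insert.2 ⟨h, hv⟩))
  · have := d₁ M v hv
    have := d₂ M v hv
    simp_all

/-- The truth of `c` does not depend on the variable `i`. -/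
def SignedFormula.Fresh (i : ℕ) (c : SignedFormula L) : Prop :=
  i ∉ c.formula.freeVarFinset ∧ ∀ j, i ∉ (c.args j).varFinset

theorem realize_update_of_notMem {M : Type*} [L.Structure M] {t : L.Term ℕ} {i : ℕ}
    (h : i ∉ t.varFinset) (v : ℕ → M) (m : M) :
    t.realize (Function.update v i m) = t.realize v := by
  induction t with
  | var k =>
    have : k ≠ i := by rintro rfl; simp at h
    simp [this]
  | func f ts ih =>
    simp only [Term.realize]
    congr 1; funext j
    exact ih j fun hj => h (by simpa using ⟨j, hj⟩)

theorem SignedFormula.Fresh.holds_update {i : ℕ} {c : SignedFormula L} (h : c.Fresh i)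
    {M : Type*} [L.Structure M] (v : ℕ → M) (m : M) :
    c.Holds (Function.update v i m) ↔ c.Holds v := by
  unfold SignedFormula.Holds
  simp only [realize_update_of_notMem (h.2 _)]
  rw [realize_congr (v' := v)]
  intro a ha
  exact Function.update_of_ne (by rintro rfl; exact h.1 ha) _ _

theorem finite_not_fresh (c : SignedFormula L) : {i | ¬ c.Fresh i}.Finite := by
  refine ((c.formula.freeVarFinset ∪
    Finset.univ.biUnion fun j => (c.args j).varFinset).finite_toSet).subset fun i hi => ?_
  by_contra h
  refine hi ⟨fun h' => h (by simp [h']), fun j hj => h ?_⟩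
  simp only [Finset.coe_union, Finset.coe_biUnion, Set.mem_union, Set.mem_iUnion]
  exact Or.inr ⟨j, by simp, hj⟩

theorem exists_fresh (hΓ : Γ.Finite) : ∃ i, ∀ c ∈ Γ, c.Fresh i := by
  obtain ⟨i, hi⟩ := (hΓ.biUnion fun c _ => finite_not_fresh c).exists_notMem
  exact ⟨i, fun c hc => by_contra fun h => hi (Set.mem_biUnion hc h)⟩

theorem holds_snoc {M : Type*} [L.Structure M] {b : Bool} {n : ℕ}
    {φ : L.BoundedFormula ℕ (n + 1)} {xs : Fin n → L.Term ℕ} {t : L.Term ℕ} {v : ℕ → M} :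
    (⟨b, φ, Fin.snoc xs t⟩ : SignedFormula L).Holds v ↔
      (φ.Realize v (Fin.snoc (fun i => (xs i).realize v) (t.realize v)) ↔ b = true) := by
  unfold SignedFormula.Holds
  have : (fun i => Term.realize v (Fin.snoc (α := fun _ => L.Term ℕ) xs t i)) =
      (Fin.snoc (fun i => (xs i).realize v) (t.realize v) : Fin (n + 1) → M) := by
    funext j
    refine Fin.lastCases ?_ (fun j => ?_) j <;> simp
  simp only [this]

/-- The given separator may mention the witness variable `i`. Quantifying it existentially repairs
this: `Γ` supplies a value for `i`, and `Δ`, being independent of `i`, refutes every value. -/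
theorem Separable.of_witness {n : ℕ} {φ : L.BoundedFormula ℕ (n + 1)} {xs : Fin n → L.Term ℕ}
    {i : ℕ} (hΓi : ∀ c ∈ Γ, c.Fresh i) (hΔi : ∀ c ∈ Δ, c.Fresh i)
    (hc : (⟨false, φ.all, xs⟩ : SignedFormula L) ∈ Γ)
    (h : Separable.{u, v, x} P Q (insert ⟨false, φ, Fin.snoc xs (var i)⟩ Γ) Δ) :
    Separable.{u, v, x} P Q Γ Δ := by
  obtain ⟨H, h₁, h₂, h₃⟩ := h
  refine ⟨exVar i H, by simpa [Admits, exVar] using h₁, fun M _ v hv => ?_, fun M _ v hv => ?_⟩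
  · have hn := hv _ hc
    simp only [SignedFormula.Holds, BoundedFormula.realize_all, Bool.false_eq_true, iff_false,
      not_forall] at hn
    obtain ⟨m, hm⟩ := hn
    refine realize_exVar.2 ⟨m, h₂ M _ (Set.forall_mem_insert.2 ⟨?_, fun c hc => ?_⟩)⟩
    · rw [holds_snoc]
      simp only [Term.realize_var, Function.update_self, Bool.false_eq_true, iff_false]
      have hf := hΓi _ hc
      simp only [realize_update_of_notMem (hf.2 _)]
      rwa [realize_congr (v' := v)]
      intro a ha
      exact Function.update_of_ne (by rintro rfl; exact hf.1 ha) _ _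
    · exact ((hΓi c hc).holds_update v m).2 (hv c hc)
  · rw [Formula.realize_not, realize_exVar]
    rintro ⟨m, hm⟩
    exact h₃ M _ (fun c hc => ((hΔi c hc).holds_update v m).2 (hv c hc)) hm

/-! ### Equational consequences and clashes of literals -/

/-- `A` consists of positive equalities admitted by `P`. -/
def EqOnly (P : Polarity L) (A : L.Formula ℕ) : Prop :=
  preds A = ∅ ∧ (EqOccurs true A → P.eq) ∧ ¬ EqOccurs false A

/-- The equation `s = t` follows from positive equational consequences of `Γ` and `Δ`. -/
def EqProv (P Q : Polarity L) (Γ Δ : Set (SignedFormula L)) (s t : L.Term ℕ) : Prop :=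
  ∃ A B, EqOnly P A ∧ EqOnly Q B ∧ Entails.{u, v, x} Γ A ∧ Entails.{u, v, x} Δ B ∧
    ∀ (M : Type x) [L.Structure M] (v : ℕ → M), A.Realize v → B.Realize v →
      s.realize v = t.realize v

/-- Simultaneous version of `EqProv`. -/
def EqProvAll (P Q : Polarity L) (Γ Δ : Set (SignedFormula L)) {ι : Type*}
    (S : Set ι) (s t : ι → L.Term ℕ) : Prop :=
  ∃ A B, EqOnly P A ∧ EqOnly Q B ∧ Entails.{u, v, x} Γ A ∧ Entails.{u, v, x} Δ B ∧
    ∀ (M : Type x) [L.Structure M] (v : ℕ → M), A.Realize v → B.Realize v →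
      ∀ i ∈ S, (s i).realize v = (t i).realize v

theorem EqOnly.top : EqOnly P (⊤ : L.Formula ℕ) := by
  have h : (⊤ : L.Formula ℕ) = (⊥ : L.Formula ℕ).not := rfl
  simp [EqOnly, h]

theorem EqOnly.inf {A B : L.Formula ℕ} (hA : EqOnly P A) (hB : EqOnly P B) :
    EqOnly P (A ⊓ B) := by
  refine ⟨by simp [hA.1, hB.1], fun h => ?_, fun h => ?_⟩ <;> rw [eqOccurs_inf] at h
  · exact h.elim hA.2.1 hB.2.1
  · exact h.elim hA.2.2 hB.2.2

theorem EqOnly.equal (hP : P.eq) (s t : L.Term ℕ) : EqOnly P (s.equal t) :=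
  ⟨rfl, fun _ => hP, Bool.false_ne_true⟩

theorem Entails.inf {A B : L.Formula ℕ} (hA : Entails.{u, v, x} Γ A)
    (hB : Entails.{u, v, x} Γ B) : Entails.{u, v, x} Γ (A ⊓ B) :=
  fun M _ v hv => Formula.realize_inf.2 ⟨hA M v hv, hB M v hv⟩

theorem Entails.top : Entails.{u, v, x} Γ ⊤ := fun M _ v _ => by simp

theorem EqProv.mono {s t : L.Term ℕ} (h : EqProv.{u, v, x} P Q Γ Δ s t) (hΓ : Γ ⊆ Γ')
    (hΔ : Δ ⊆ Δ') : EqProv.{u, v, x} P Q Γ' Δ' s t := by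
  obtain ⟨A, B, a, b, c, d, e⟩ := h
  exact ⟨A, B, a, b, c.mono hΓ, d.mono hΔ, e⟩

theorem EqProv.swap {s t : L.Term ℕ} (h : EqProv.{u, v, x} P Q Γ Δ s t) :
    EqProv.{u, v, x} Q P Δ Γ s t := by
  obtain ⟨A, B, a, b, c, d, e⟩ := h
  exact ⟨B, A, b, a, d, c, fun M _ v hB hA => e M v hA hB⟩

theorem EqProv.refl (t : L.Term ℕ) : EqProv.{u, v, x} P Q Γ Δ t t :=
  ⟨⊤, ⊤, EqOnly.top, EqOnly.top, Entails.top, Entails.top, fun _ _ _ _ _ => rfl⟩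

theorem EqProv.symm {s t : L.Term ℕ} (h : EqProv.{u, v, x} P Q Γ Δ s t) :
    EqProv.{u, v, x} P Q Γ Δ t s := by
  obtain ⟨A, B, a, b, c, d, e⟩ := h
  exact ⟨A, B, a, b, c, d, fun M _ v hA hB => (e M v hA hB).symm⟩

theorem EqProv.trans {r s t : L.Term ℕ} (h : EqProv.{u, v, x} P Q Γ Δ r s)
    (h' : EqProv.{u, v, x} P Q Γ Δ s t) : EqProv.{u, v, x} P Q Γ Δ r t := by
  obtain ⟨A, B, a, b, c, d, e⟩ := h
  obtain ⟨A', B', a', b', c', d', e'⟩ := h'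
  refine ⟨A ⊓ A', B ⊓ B', a.inf a', b.inf b', c.inf c', d.inf d', fun M _ v hA hB => ?_⟩
  rw [Formula.realize_inf] at hA hB
  exact (e M v hA.1 hB.1).trans (e' M v hA.2 hB.2)

theorem EqProvAll.of_forall {ι : Type*} [Finite ι] {s t : ι → L.Term ℕ}
    (h : ∀ i, EqProv.{u, v, x} P Q Γ Δ (s i) (t i)) :
    EqProvAll.{u, v, x} P Q Γ Δ Set.univ s t := by
  refine Set.finite_univ.induction_on _ ?_ fun {i S} _ _ ih => ?_
  · exact ⟨⊤, ⊤, EqOnly.top, EqOnly.top, Entails.top, Entails.top, by simp⟩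
  · obtain ⟨A, B, a, b, c, d, e⟩ := h i
    obtain ⟨A', B', a', b', c', d', e'⟩ := ih
    refine ⟨A ⊓ A', B ⊓ B', a.inf a', b.inf b', c.inf c', d.inf d', fun M _ v hA hB => ?_⟩
    rw [Formula.realize_inf] at hA hB
    exact Set.forall_mem_insert.2 ⟨e M v hA.1 hB.1, e' M v hA.2 hB.2⟩

theorem EqProv.func {n : ℕ} (f : L.Functions n) {s t : Fin n → L.Term ℕ}
    (h : ∀ i, EqProv.{u, v, x} P Q Γ Δ (s i) (t i)) :
    EqProv.{u, v, x} P Q Γ Δ (func f s) (func f t) := by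
  obtain ⟨A, B, a, b, c, d, e⟩ := EqProvAll.of_forall h
  refine ⟨A, B, a, b, c, d, fun M _ v hA hB => ?_⟩
  simp only [Term.realize_func]
  exact congrArg _ (funext fun i => e M v hA hB i trivial)

/-- Contradictory equational consequences on one side yield a separating formula. -/
theorem Separable.of_eqOnly {B : L.Formula ℕ} (hB : EqOnly Q B) (hΔ : Entails.{u, v, x} Δ B)
    (hΓ : Entails.{u, v, x} Γ B.not) : Separable.{u, v, x} P Q Γ Δ :=
  ⟨B.not, ⟨by simp [hB.1], fun h => (hB.2.2 (by simpa using h)).elim,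
    fun h => hB.2.1 (by simpa using h)⟩, hΓ, fun M _ v hv => by simpa using hΔ M v hv⟩

/-- In models of `Γ` the formula `A` holds, so `B` would force the refuted equation. Thus `Γ`
refutes `B`, and `¬B` separates without using equality positively. -/
theorem Separable.of_ne {s t : L.Term ℕ} (h : EqProv.{u, v, x} P Q Γ Δ s t)
    (hst : Entails.{u, v, x} Γ (s.equal t).not) : Separable.{u, v, x} P Q Γ Δ := by
  obtain ⟨A, B, a, b, c, d, e⟩ := h
  refine .of_eqOnly b d fun M _ v hv => Formula.realize_not.2 fun hB => ?_
  exact Formula.realize_not.1 (hst M v hv) (Formula.realize_equal.2 (e M v (c M v hv) hB))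

theorem Separable.of_rel_same {n : ℕ} {R : L.Relations n} {s t : Fin n → L.Term ℕ}
    (h : ∀ i, EqProv.{u, v, x} P Q Γ Δ (s i) (t i)) (hs : Entails.{u, v, x} Γ (R.formula s))
    (ht : Entails.{u, v, x} Γ (R.formula t).not) : Separable.{u, v, x} P Q Γ Δ := by
  obtain ⟨A, B, a, b, c, d, e⟩ := EqProvAll.of_forall h
  refine .of_eqOnly b d fun M _ v hv => Formula.realize_not.2 fun hB => ?_
  refine Formula.realize_not.1 (ht M v hv) ?_
  have := hs M v hv
  rw [Formula.realize_rel] at this ⊢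
  rwa [← funext fun i => e M v (c M v hv) hB i trivial]

theorem preds_formula {n : ℕ} (R : L.Relations n) (s : Fin n → L.Term ℕ) :
    preds (R.formula s) = {(true, ⟨n, R⟩)} := rfl

theorem not_eqOccurs_formula {n : ℕ} (b : Bool) (R : L.Relations n) (s : Fin n → L.Term ℕ) :
    ¬ EqOccurs b (R.formula s) := id

/-- The separator is `A ∧ (B → R s)`. In models of `Δ`, where `B` holds, it would give `s = t` and
`R s`, hence the refuted `R t`. -/
theorem Separable.of_rel_cross {n : ℕ} {R : L.Relations n} {s t : Fin n → L.Term ℕ}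
    (hP : (true, ⟨n, R⟩) ∈ P.rel) (hQ : (false, ⟨n, R⟩) ∈ Q.rel)
    (h : ∀ i, EqProv.{u, v, x} P Q Γ Δ (s i) (t i)) (hs : Entails.{u, v, x} Γ (R.formula s))
    (ht : Entails.{u, v, x} Δ (R.formula t).not) : Separable.{u, v, x} P Q Γ Δ := by
  obtain ⟨A, B, a, b, c, d, e⟩ := EqProvAll.of_forall h
  refine ⟨A ⊓ B.imp (R.formula s), ⟨fun k p hp => ?_, fun he => ?_, fun he => ?_⟩,
    fun M _ v hv => ?_, fun M _ v hv => ?_⟩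
  · simp only [preds_inf, preds_imp, a.1, b.1, preds_formula] at hp
    simp only [Set.mem_empty_iff_false, Set.ofPred_false, Set.empty_union,
      Set.mem_singleton_iff, Prod.mk.injEq] at hp
    obtain ⟨rfl, rfl⟩ := hp
    exact ⟨hP, hQ⟩
  · simp only [eqOccurs_inf, eqOccurs_imp, not_eqOccurs_formula, or_false] at he
    exact he.elim a.2.1 fun h => (b.2.2 h).elim
  · simp only [eqOccurs_inf, eqOccurs_imp, not_eqOccurs_formula, or_false] at he
    exact he.elim (fun h => (a.2.2 h).elim) b.2.1
  · exact Formula.realize_inf.2 ⟨c M v hv, Formula.realize_imp.2 fun _ => hs M v hv⟩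
  · rw [Formula.realize_not, Formula.realize_inf, Formula.realize_imp]
    rintro ⟨hA, hB⟩
    refine Formula.realize_not.1 (ht M v hv) ?_
    have := hB (d M v hv)
    rw [Formula.realize_rel] at this ⊢
    rwa [← funext fun i => e M v hA (d M v hv) i trivial]

end Separation

/-! ### Inseparable pairs as forcing conditions, and a generic ideal -/

section Generic

variable {L : FirstOrder.Language.{u, v}}

/-- The subformulas of a formula. -/
def subformulas : {n : ℕ} → L.BoundedFormula ℕ n → Set (Σ n, L.BoundedFormula ℕ n)
  | n, .imp φ ψ => insert ⟨n, .imp φ ψ⟩ (subformulas φ ∪ subformulas ψ)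
  | n, .all φ => insert ⟨n, .all φ⟩ (subformulas φ)
  | n, φ => {⟨n, φ⟩}

theorem finite_subformulas {n : ℕ} (φ : L.BoundedFormula ℕ n) : (subformulas φ).Finite := by
  induction φ with
  | falsum | equal | rel => exact Set.finite_singleton _
  | imp _ _ ih₁ ih₂ => exact (ih₁.union ih₂).insert _
  | all _ ih => exact ih.insert _

theorem self_mem_subformulas {n : ℕ} (φ : L.BoundedFormula ℕ n) : ⟨n, φ⟩ ∈ subformulas φ := by
  cases φ <;> simp [subformulas]

/-- A set of formulas is closed under subformulas. -/
structure SubClosed (X : Set (Σ n, L.BoundedFormula ℕ n)) : Prop where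
  left : ∀ {n} {φ ψ : L.BoundedFormula ℕ n}, ⟨n, φ.imp ψ⟩ ∈ X → ⟨n, φ⟩ ∈ X
  right : ∀ {n} {φ ψ : L.BoundedFormula ℕ n}, ⟨n, φ.imp ψ⟩ ∈ X → ⟨n, ψ⟩ ∈ X
  body : ∀ {n} {φ : L.BoundedFormula ℕ (n + 1)}, ⟨n, φ.all⟩ ∈ X → ⟨n + 1, φ⟩ ∈ X

theorem SubClosed.union {X Y : Set (Σ n, L.BoundedFormula ℕ n)} (hX : SubClosed X)
    (hY : SubClosed Y) : SubClosed (X ∪ Y) :=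
  ⟨fun h => h.imp hX.left hY.left, fun h => h.imp hX.right hY.right,
    fun h => h.imp hX.body hY.body⟩

theorem subClosed_subformulas {n : ℕ} (φ : L.BoundedFormula ℕ n) :
    SubClosed (subformulas φ) := by
  induction φ with
  | falsum | equal | rel =>
    constructor <;> intros <;> rename_i h <;> cases Set.mem_singleton_iff.1 h
  | @imp k φ₁ φ₂ ih₁ ih₂ =>
    have ih := ih₁.union ih₂
    refine ⟨fun h => ?_, fun h => ?_, fun h => ?_⟩ <;> rw [subformulas] at h ⊢ <;>
      rcases h with h | h
    · cases h; exact Or.inr (Or.inl (self_mem_subformulas _))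
    · exact Or.inr (ih.left h)
    · cases h; exact Or.inr (Or.inr (self_mem_subformulas _))
    · exact Or.inr (ih.right h)
    · cases h
    · exact Or.inr (ih.body h)
  | @all k φ ih =>
    refine ⟨fun h => ?_, fun h => ?_, fun h => ?_⟩ <;> rw [subformulas] at h ⊢ <;>
      rcases h with h | h
    · cases h
    · exact Or.inr (ih.left h)
    · cases h
    · exact Or.inr (ih.right h)
    · cases h; exact Or.inr (self_mem_subformulas _)
    · exact Or.inr (ih.body h)

/-- The signed formula is built from a member of `X` and its symbols are admitted by `P`. -/
def SignedFormula.Allowed (X : Set (Σ n, L.BoundedFormula ℕ n)) (P : Polarity L)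
    (c : SignedFormula L) : Prop :=
  ⟨c.arity, c.formula⟩ ∈ X ∧ c.Within P

/-- A finite inseparable pair of sets of signed formulas. -/
structure Condition (P : Bool → Polarity L) (X : Set (Σ n, L.BoundedFormula ℕ n)) where
  /-- The two sets of signed formulas. -/
  side : Bool → Set (SignedFormula L)
  finite : ∀ s, (side s).Finite
  allowed : ∀ s, ∀ c ∈ side s, c.Allowed X (P s)
  -- Both orientations are recorded, though equivalent by symmetry, so that arguments can be made
  -- uniformly in the side `s`.
  insep : ∀ s, ¬ Separable.{u, v, x} (P s) (P !s) (side s) (side !s)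

variable {P : Bool → Polarity L} {X : Set (Σ n, L.BoundedFormula ℕ n)}

instance : Preorder (Condition.{u, v, x} P X) where
  le p q := ∀ s, p.side s ⊆ q.side s
  le_refl _ _ := subset_rfl
  le_trans _ _ _ h h' s := (h s).trans (h' s)

theorem Condition.exists_extension (p : Condition.{u, v, x} P X) (s : Bool)
    {E : Set (SignedFormula L)} (hE : E.Finite) (hA : ∀ c ∈ E, c.Allowed X (P s))
    (h : ¬ Separable.{u, v, x} (P s) (P !s) (E ∪ p.side s) (p.side !s)) :
    ∃ q : Condition.{u, v, x} P X, p ≤ q ∧ E ⊆ q.side s := by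
  have key : ∀ r, (if r = s then E ∪ p.side r else p.side r).Finite := fun r => by
    split_ifs
    exacts [hE.union (p.finite r), p.finite r]
  refine ⟨⟨fun r => if r = s then E ∪ p.side r else p.side r, key, fun r c hc => ?_,
    fun r hr => ?_⟩, fun r => ?_, by simp⟩
  · split_ifs at hc with hrs
    · subst hrs
      exact hc.elim (hA c) (p.allowed r c)
    · exact p.allowed r c hc
  · by_cases hrs : r = s
    · subst hrs
      simp only [if_true, Bool.not_eq_self, if_false] at hr
      exact h hr
    · obtain rfl : r = !s := by revert hrs; cases r <;> cases s <;> simp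
      refine h ?_
      simpa using hr.symm
  · dsimp only
    split_ifs
    exacts [Set.subset_union_right, subset_rfl]

/-- The signed formula `c` is decomposed on side `s`, for the instance `t` of a universal
quantifier. -/
def Resolved (G : Bool → Set (SignedFormula L)) (s : Bool) (t : L.Term ℕ) :
    SignedFormula L → Prop
  | ⟨true, .imp φ ψ, xs⟩ => ⟨false, φ, xs⟩ ∈ G s ∨ ⟨true, ψ, xs⟩ ∈ G s
  | ⟨false, .imp φ ψ, xs⟩ => ⟨true, φ, xs⟩ ∈ G s ∧ ⟨false, ψ, xs⟩ ∈ G s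
  | ⟨true, .all φ, xs⟩ => ⟨true, φ, Fin.snoc xs t⟩ ∈ G s
  | ⟨false, .all φ, xs⟩ => ∃ i, ⟨false, φ, Fin.snoc xs (var i)⟩ ∈ G s
  | _ => True

theorem SignedFormula.Allowed.left {P : Polarity L} (hX : SubClosed X) {b : Bool} {n : ℕ}
    {φ ψ : L.BoundedFormula ℕ n} {xs : Fin n → L.Term ℕ}
    (h : (⟨b, φ.imp ψ, xs⟩ : SignedFormula L).Allowed X P) :
    (⟨!b, φ, xs⟩ : SignedFormula L).Allowed X P := by
  refine ⟨hX.left h.1, fun k p hp => ?_, fun he => h.2.2 (Or.inl he)⟩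
  have := h.2.1 (!k) p (Or.inl (by simpa using hp))
  revert this; cases k <;> cases b <;> simp

theorem SignedFormula.Allowed.right {P : Polarity L} (hX : SubClosed X) {b : Bool} {n : ℕ}
    {φ ψ : L.BoundedFormula ℕ n} {xs : Fin n → L.Term ℕ}
    (h : (⟨b, φ.imp ψ, xs⟩ : SignedFormula L).Allowed X P) :
    (⟨b, ψ, xs⟩ : SignedFormula L).Allowed X P :=
  ⟨hX.right h.1, fun k p hp => h.2.1 k p (Or.inr hp), fun he => h.2.2 (Or.inr he)⟩

theorem SignedFormula.Allowed.body {P : Polarity L} (hX : SubClosed X) {b : Bool} {n : ℕ}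
    {φ : L.BoundedFormula ℕ (n + 1)} {xs : Fin n → L.Term ℕ} {ys : Fin (n + 1) → L.Term ℕ}
    (h : (⟨b, φ.all, xs⟩ : SignedFormula L).Allowed X P) :
    (⟨b, φ, ys⟩ : SignedFormula L).Allowed X P :=
  ⟨hX.body h.1, h.2.1, h.2.2⟩

/-- Contrapositive of the separation rules: if the extension were separable, so would be `p`. -/
theorem Condition.exists_resolved (hX : SubClosed X) (p : Condition.{u, v, x} P X) (s : Bool)
    (t : L.Term ℕ) (c : SignedFormula L) (hc : c ∈ p.side s) :
    ∃ q, p ≤ q ∧ Resolved q.side s t c := by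
  have hA := p.allowed s c hc
  have ext (E : Set (SignedFormula L)) := p.exists_extension s (E := E)
  match c, hc, hA with
  | ⟨true, .imp φ ψ, xs⟩, hc, hA =>
    by_cases h : Separable.{u, v, x} (P s) (P !s) ({⟨false, φ, xs⟩} ∪ p.side s) (p.side !s)
    · have h' : ¬ Separable.{u, v, x} (P s) (P !s) ({⟨true, ψ, xs⟩} ∪ p.side s) (p.side !s) := by
        refine fun h' => p.insep s (h.or h' fun M _ v hv => ?_)
        have := hv _ hc
        simp only [SignedFormula.Holds, BoundedFormula.realize_imp, iff_true, Bool.false_eq_true,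
          iff_false] at this ⊢
        tauto
      obtain ⟨q, hq, hE⟩ := ext _ (Set.finite_singleton _) (by simpa using hA.right hX) h'
      exact ⟨q, hq, Or.inr (hE rfl)⟩
    · obtain ⟨q, hq, hE⟩ := ext _ (Set.finite_singleton _) (by simpa using hA.left hX) h
      exact ⟨q, hq, Or.inl (hE rfl)⟩
  | ⟨false, .imp φ ψ, xs⟩, hc, hA =>
    obtain ⟨q, hq, hE⟩ := ext {⟨true, φ, xs⟩, ⟨false, ψ, xs⟩} (Set.toFinite _)
      (by rintro c (rfl | rfl); exacts [hA.left hX, hA.right hX])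
      (fun h => p.insep s (h.of_entails fun M _ v hv c' hc' => by
        have := hv _ hc
        simp only [SignedFormula.Holds, BoundedFormula.realize_imp, Bool.false_eq_true, iff_false,
          Classical.not_imp] at this
        rcases hc' with (rfl | rfl) | hc'
        · simpa [SignedFormula.Holds] using this.1
        · simpa [SignedFormula.Holds] using this.2
        · exact hv _ hc'))
    exact ⟨q, hq, hE (by simp), hE (by simp)⟩
  | ⟨true, .all φ, xs⟩, hc, hA =>
    obtain ⟨q, hq, hE⟩ := ext {⟨true, φ, Fin.snoc xs t⟩} (Set.finite_singleton _)
      (by rintro c rfl; exact hA.body hX)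
      (fun h => p.insep s (h.of_entails fun M _ v hv c' hc' => by
        rcases hc' with rfl | hc'
        · have := hv _ hc
          simp only [SignedFormula.Holds, BoundedFormula.realize_all, iff_true] at this
          simpa [holds_snoc] using this _
        · exact hv _ hc'))
    exact ⟨q, hq, hE rfl⟩
  | ⟨false, .all φ, xs⟩, hc, hA =>
    obtain ⟨i, hi⟩ := exists_fresh ((p.finite s).union (p.finite !s))
    obtain ⟨q, hq, hE⟩ := ext {⟨false, φ, Fin.snoc xs (var i)⟩} (Set.finite_singleton _)
      (by rintro c rfl; exact hA.body hX)
      (fun h => p.insep s (h.of_witness (fun c h => hi c (Or.inl h))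
        (fun c h => hi c (Or.inr h)) hc))
    exact ⟨q, hq, i, hE rfl⟩
  | ⟨true, .falsum, xs⟩, _, _ | ⟨false, .falsum, xs⟩, _, _ => exact ⟨p, le_rfl, trivial⟩
  | ⟨true, .equal _ _, xs⟩, _, _ | ⟨false, .equal _ _, xs⟩, _, _ => exact ⟨p, le_rfl, trivial⟩
  | ⟨true, .rel _ _, xs⟩, _, _ | ⟨false, .rel _ _, xs⟩, _, _ => exact ⟨p, le_rfl, trivial⟩

/-- The Rasiowa–Sikorski argument. Only formulas of the countable set `X` serve as indices, so there
may be uncountably many relation symbols. -/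
theorem exists_generic [Countable (Σ n, L.Functions n)] (hX : SubClosed X) (hXc : X.Countable)
    (p : Condition.{u, v, x} P X) :
    ∃ I : Order.Ideal (Condition.{u, v, x} P X), p ∈ I ∧
      ∀ s t c, ∀ q ∈ I, c ∈ q.side s → ∃ r ∈ I, Resolved r.side s t c := by
  have := hXc.to_subtype
  let := Encodable.ofCountable (Σ n, L.Functions n)
  let ι := Bool × L.Term ℕ × Bool × Σ φ : X, (Fin φ.1.1 → L.Term ℕ)
  let : Encodable ι := Encodable.ofCountable ι
  let c (i : ι) : SignedFormula L := ⟨i.2.2.1, i.2.2.2.1.1.2, i.2.2.2.2⟩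
  let D (i : ι) : Order.Cofinal (Condition.{u, v, x} P X) :=
    -- The first alternative makes the set cofinal even if `c i` can never be added. Directedness
    -- excludes it once `c i` occurs in a member of the ideal.
    ⟨{q | (∀ r, q ≤ r → c i ∉ r.side i.1) ∨ Resolved q.side i.1 i.2.1 (c i)}, fun q => by
      by_cases h : ∀ r, q ≤ r → c i ∉ r.side i.1
      · exact ⟨q, Or.inl h, le_rfl⟩
      · push Not at h
        obtain ⟨r, hqr, hr⟩ := h
        obtain ⟨r', hr', h'⟩ := r.exists_resolved hX i.1 i.2.1 (c i) hr
        exact ⟨r', Or.inr h', hqr.trans hr'⟩⟩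
  refine ⟨Order.idealOfCofinals p D, Order.mem_idealOfCofinals p D, fun s t d q hq hd => ?_⟩
  obtain ⟨r, hr, hrI⟩ := Order.cofinal_meets_idealOfCofinals p D
    (s, t, d.sign, ⟨⟨_, (q.allowed s d hd).1⟩, d.args⟩)
  obtain ⟨r', -, hqr, hrr⟩ := (Order.idealOfCofinals p D).directed q hq r hrI
  exact ⟨r, hrI, hr.resolve_left fun h => h r' hrr (hqr s hd)⟩

end Generic

/-! ### The term model of a generic ideal and the truth lemma -/

section TermModel

variable {L : FirstOrder.Language.{u, v}} {P : Bool → Polarity L}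
  {X : Set (Σ n, L.BoundedFormula ℕ n)} (I : Order.Ideal (Condition.{u, v, x} P X))

/-- Two terms are provably equal from the positive equations of the conditions in `I`. -/
def ProvEq (s t : L.Term ℕ) : Prop :=
  ∃ p ∈ I, EqProv.{u, v, x} (P true) (P false) (p.side true) (p.side false) s t

variable {I}

theorem provEq_iff (b : Bool) {s t : L.Term ℕ} : ProvEq I s t ↔
    ∃ p ∈ I, EqProv.{u, v, x} (P b) (P !b) (p.side b) (p.side !b) s t := by
  cases b
  · exact exists_congr fun p => and_congr_right fun _ => ⟨EqProv.swap, EqProv.swap⟩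
  · rfl

/-- Directedness of the ideal merges finitely many witnesses of monotone properties. -/
theorem exists_forall_of_forall_exists {ι : Type*} [Finite ι]
    {R : ι → Condition.{u, v, x} P X → Prop} (hR : ∀ i p q, p ≤ q → R i p → R i q)
    (h : ∀ i, ∃ p ∈ I, R i p) : ∃ p ∈ I, ∀ i, R i p := by
  suffices ∀ S : Set ι, S.Finite → ∃ p ∈ I, ∀ i ∈ S, R i p by
    simpa using this Set.univ Set.finite_univ
  intro S hS
  refine hS.induction_on _ ?_ fun {i S} _ _ ih => ?_
  · obtain ⟨p, hp⟩ := I.nonempty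
    exact ⟨p, hp, by simp⟩
  · obtain ⟨p, hp, hpi⟩ := h i
    obtain ⟨q, hq, hqS⟩ := ih
    obtain ⟨r, hr, hpr, hqr⟩ := I.directed p hp q hq
    exact ⟨r, hr, Set.forall_mem_insert.2 ⟨hR i p r hpr hpi, fun j hj => hR j q r hqr (hqS j hj)⟩⟩

theorem exists_eqProv_forall (b : Bool) {ι : Type*} [Finite ι] {s t : ι → L.Term ℕ}
    (h : ∀ i, ProvEq I (s i) (t i)) :
    ∃ p ∈ I, ∀ i, EqProv.{u, v, x} (P b) (P !b) (p.side b) (p.side !b) (s i) (t i) :=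
  exists_forall_of_forall_exists (fun _ _ _ hpq h => h.mono (hpq _) (hpq _))
    fun i => (provEq_iff b).1 (h i)

variable (I)

/-- Provable equality as a setoid. -/
def termSetoid : Setoid (L.Term ℕ) where
  r := ProvEq I
  iseqv :=
    { refl := fun t => by
        obtain ⟨p, hp⟩ := I.nonempty
        exact ⟨p, hp, EqProv.refl t⟩
      symm := fun ⟨p, hp, h⟩ => ⟨p, hp, h.symm⟩
      trans := fun ⟨p, hp, h⟩ ⟨q, hq, h'⟩ => by
        obtain ⟨r, hr, hpr, hqr⟩ := I.directed p hp q hq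
        exact ⟨r, hr, (h.mono (hpr _) (hpr _)).trans (h'.mono (hqr _) (hqr _))⟩ }

/-- The structure of terms in which an atom holds if, up to provable equality, it is a
consequence of one of the sides. -/
instance termPrestructure : L.Prestructure (termSetoid I) where
  toStructure :=
    { funMap := fun f ts => func f ts
      -- The admissibility of positive `R` on side `b` is recorded because the separator for a clash
      -- across sides contains `R` positively.
      RelMap := fun {n} R ts => ∃ us : Fin n → L.Term ℕ, (∀ i, ProvEq I (ts i) (us i)) ∧
        ∃ b, ∃ p ∈ I, (true, ⟨n, R⟩) ∈ (P b).rel ∧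
          Entails.{u, v, x} (p.side b) (R.formula us) }
  fun_equiv := fun {n f} s t h => by
    obtain ⟨p, hp, h⟩ := exists_eqProv_forall true h
    exact ⟨p, hp, EqProv.func f h⟩
  rel_equiv := fun {n R} s t h => by
    refine propext (exists_congr fun us => and_congr_left fun _ => forall_congr' fun i => ?_)
    exact ⟨(termSetoid I).trans ((termSetoid I).symm (h i)), (termSetoid I).trans (h i)⟩

/-- The model of terms modulo provable equality. -/
abbrev TermModel : Type u := Quotient (termSetoid I)

theorem realize_termModel {n : ℕ} (t : L.Term (ℕ ⊕ Fin n)) (xs : Fin n → L.Term ℕ) :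
    t.realize (Sum.elim (fun i => (⟦var i⟧ : TermModel I)) (fun j => ⟦xs j⟧)) =
      ⟦t.subst (Sum.elim var xs)⟧ := by
  have h : Sum.elim (fun i => (⟦var i⟧ : TermModel I)) (fun j => ⟦xs j⟧) =
      fun z => ⟦Sum.elim var xs z⟧ := by
    funext z; cases z <;> rfl
  rw [h, Term.realize_quotient_mk']
  congr 1
  induction t with
  | var => rfl
  | func f ts ih => exact congrArg (func f) (funext ih)

theorem realize_args {M : Type*} [L.Structure M] (v : ℕ → M) {n : ℕ}
    (t : L.Term (ℕ ⊕ Fin n)) (xs : Fin n → L.Term ℕ) :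
    t.realize (Sum.elim v fun i => (xs i).realize v) =
      (t.subst (Sum.elim var xs)).realize v := by
  rw [Term.realize_subst]
  congr 1
  funext z; cases z <;> rfl

theorem holds_equal {M : Type*} [L.Structure M] {v : ℕ → M} {b : Bool} {n : ℕ}
    {s t : L.Term (ℕ ⊕ Fin n)} {xs : Fin n → L.Term ℕ} :
    (⟨b, .equal s t, xs⟩ : SignedFormula L).Holds v ↔
      (((s.subst (Sum.elim var xs)).equal (t.subst (Sum.elim var xs))).Realize v ↔
        b = true) := by
  simp only [SignedFormula.Holds, BoundedFormula.Realize, realize_args, Formula.realize_equal]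

theorem holds_rel {M : Type*} [L.Structure M] {v : ℕ → M} {b : Bool} {n k : ℕ}
    {R : L.Relations k} {ts : Fin k → L.Term (ℕ ⊕ Fin n)} {xs : Fin n → L.Term ℕ} :
    (⟨b, .rel R ts, xs⟩ : SignedFormula L).Holds v ↔
      ((R.formula fun i => (ts i).subst (Sum.elim var xs)).Realize v ↔ b = true) := by
  simp only [SignedFormula.Holds, BoundedFormula.Realize, realize_args, Formula.realize_rel]

variable {I}

/-- The truth lemma. Genericity handles connectives and quantifiers. For literals, a false value in
the wrong place would make some condition of the ideal separable. -/
theorem realize_of_mem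
    (hI : ∀ s t c, ∀ q ∈ I, c ∈ q.side s → ∃ r ∈ I, Resolved r.side s t c) {n : ℕ}
    (φ : L.BoundedFormula ℕ n) (b s : Bool) (xs : Fin n → L.Term ℕ) {p : Condition.{u, v, x} P X}
    (hp : p ∈ I) (hc : ⟨b, φ, xs⟩ ∈ p.side s) :
    φ.Realize (fun i => (⟦var i⟧ : TermModel I)) (fun j => ⟦xs j⟧) ↔ b = true := by
  induction φ generalizing b s p with
  | falsum =>
    cases b
    · simp [BoundedFormula.Realize]
    · exact (p.insep s (.of_unsat fun M _ v hv => by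
        simpa [SignedFormula.Holds, BoundedFormula.Realize] using hv _ hc)).elim
  | equal t₁ t₂ =>
    rw [BoundedFormula.Realize, realize_termModel, realize_termModel, Quotient.eq]
    have hE := fun (M : Type x) [L.Structure M] (v : ℕ → M) (hv : ∀ c ∈ p.side s, c.Holds v) =>
      holds_equal.1 (hv _ hc)
    cases b
    · simp only [Bool.false_eq_true, iff_false] at hE ⊢
      intro h
      obtain ⟨q, hq, hqe⟩ := (provEq_iff s).1 h
      obtain ⟨r, hr, hpr, hqr⟩ := I.directed p hp q hq
      exact r.insep s (.of_ne (hqe.mono (hqr _) (hqr _))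
        fun M _ v hv => Formula.realize_not.2 (hE M v fun c hc => hv c (hpr s hc)))
    · simp only [iff_true] at hE ⊢
      -- The equation itself serves as the consequence of its own side, and `⊤` as that of the
      -- other.
      refine (provEq_iff s).2 ⟨p, hp, _, ⊤, EqOnly.equal ((p.allowed s _ hc).2.2 rfl) _ _,
        EqOnly.top, hE, Entails.top, fun M _ v h _ => Formula.realize_equal.1 h⟩
  | @rel n k R ts =>
    rw [BoundedFormula.Realize]
    simp only [realize_termModel]
    rw [relMap_quotient_mk']
    have hE := fun (M : Type x) [L.Structure M] (v : ℕ → M) (hv : ∀ c ∈ p.side s, c.Holds v) =>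
      holds_rel.1 (hv _ hc)
    have hR := (p.allowed s _ hc).2.1 true ⟨k, R⟩ rfl
    cases b
    · simp only [Bool.false_eq_true, iff_false] at hE ⊢
      rintro ⟨us, hus, b, q, hq, hqR, hqe⟩
      obtain ⟨q', hq', hqe'⟩ := exists_eqProv_forall b fun i => (termSetoid I).symm (hus i)
      obtain ⟨r₀, hr₀, hpr₀, hqr₀⟩ := I.directed p hp q hq
      obtain ⟨r, hr, hpr, hqr⟩ := I.directed r₀ hr₀ q' hq'
      have h₁ := hqe.mono ((hqr₀.trans hpr) b)
      have h₂ : Entails.{u, v, x} (r.side s)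
          (R.formula fun i => (ts i).subst (Sum.elim var xs)).not :=
        fun M _ v hv => Formula.realize_not.2 (hE M v fun c hc => hv c ((hpr₀.trans hpr) s hc))
      have h₃ := fun i => (hqe' i).mono (hqr b) (hqr !b)
      by_cases hbs : b = s
      · subst hbs
        exact r.insep b (.of_rel_same h₃ h₁ h₂)
      · obtain rfl : s = !b := by revert hbs; cases s <;> cases b <;> simp
        exact r.insep b (.of_rel_cross hqR hR h₃ h₁ h₂)
    · simp only [iff_true] at hE ⊢
      exact ⟨_, fun i => (termSetoid I).refl _, s, p, hp, hR, hE⟩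
  | imp φ ψ ih₁ ih₂ =>
    -- The term `var 0` is a dummy: only positive universal formulas use the instance.
    obtain ⟨r, hr, h⟩ := hI s (var 0) _ p hp hc
    rw [BoundedFormula.realize_imp]
    cases b
    · have h₁ := ih₁ _ _ xs hr h.1
      have h₂ := ih₂ _ _ xs hr h.2
      simp_all
    · rcases h with h | h
      · have h₁ := ih₁ _ _ xs hr h
        simp_all
      · have h₂ := ih₂ _ _ xs hr h
        simp_all
  | @all n φ ih =>
    rw [BoundedFormula.realize_all]
    have key (t : L.Term ℕ) : (Fin.snoc (fun j => (⟦xs j⟧ : TermModel I)) ⟦t⟧ :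
        Fin (n + 1) → TermModel I) = fun j => ⟦(Fin.snoc xs t : Fin (n + 1) → L.Term ℕ) j⟧ := by
      funext j
      refine Fin.lastCases ?_ (fun j => ?_) j <;> simp
    cases b
    · obtain ⟨r, hr, i, h⟩ := hI s (var 0) _ p hp hc
      simp only [Bool.false_eq_true, iff_false, not_forall]
      refine ⟨⟦var i⟧, ?_⟩
      rw [key]
      simpa using ih false s _ hr h
    · simp only [iff_true]
      intro m
      induction m using Quotient.inductionOn with
      | h t =>
        obtain ⟨r, hr, h⟩ := hI s t _ p hp hc
        rw [key]
        simpa using ih true s _ hr h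

end TermModel

/-! ### Interpolation for countably many function symbols -/

section Countable

variable {L : FirstOrder.Language.{u, v}}

theorem holds_elim0 {M : Type*} [L.Structure M] {v : ℕ → M} {b : Bool} {F : L.Formula ℕ} :
    (⟨b, F, Fin.elim0⟩ : SignedFormula L).Holds v ↔ (F.Realize v ↔ b = true) := by
  rw [SignedFormula.Holds, Formula.Realize]
  rw [Subsingleton.elim (fun i : Fin 0 => _) default]

/-- Interpolation for languages with countably many function symbols, without restrictions on
the variables and function symbols of the interpolant. -/
theorem exists_interpolant_of_countable [Countable (Σ n, L.Functions n)] (F G : L.Formula ℕ)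
    (hFG : ∀ (M : Type max u x) [L.Structure M] (v : ℕ → M), F.Realize v → G.Realize v) :
    ∃ H : L.Formula ℕ,
      (∀ (M : Type max u x) [L.Structure M] (v : ℕ → M), F.Realize v → H.Realize v) ∧
      (∀ (M : Type max u x) [L.Structure M] (v : ℕ → M), H.Realize v → G.Realize v) ∧
      preds H ⊆ preds F ∩ preds G ∧
      (EqOccurs true H → EqOccurs true F) ∧ (EqOccurs false H → EqOccurs false G) := by
  let c : Bool → SignedFormula L := fun s =>
    if s then ⟨true, F, Fin.elim0⟩ else ⟨false, G, Fin.elim0⟩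
  -- Polarities on the second side are those of the negation of `G`, hence flipped.
  let P : Bool → Polarity L := fun s => if s then ⟨preds F, EqOccurs true F⟩ else
    ⟨{q | (!q.1, q.2) ∈ preds G}, EqOccurs false G⟩
  let X := subformulas F ∪ subformulas G
  have hX : SubClosed X := (subClosed_subformulas F).union (subClosed_subformulas G)
  have hXc : X.Countable := ((finite_subformulas F).union (finite_subformulas G)).countable
  have holds_true (M : Type max u x) [L.Structure M] (v : ℕ → M) :
      (c true).Holds v ↔ F.Realize v := by
    simp [c, holds_elim0]
  have holds_false (M : Type max u x) [L.Structure M] (v : ℕ → M) :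
      (c false).Holds v ↔ ¬ G.Realize v := by
    simp [c, holds_elim0]
  by_cases hsep : Separable.{u, v, max u x} (P true) (P false) {c true} {c false}
  · obtain ⟨H, ⟨h₁, h₂, h₃⟩, h₄, h₅⟩ := hsep
    refine ⟨H, fun M _ v hF => h₄ M v (by simpa [holds_true] using hF), fun M _ v hH => ?_,
      fun q hq => ?_, h₂, h₃⟩
    · by_contra hG
      exact Formula.realize_not.1 (h₅ M v (by simpa [holds_false] using hG)) hH
    · simpa [P] using h₁ q.1 q.2 hq
  · exfalso
    let p : Condition.{u, v, max u x} P X :=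
      ⟨fun s => {c s}, fun s => Set.finite_singleton _, fun s d hd => by
        obtain rfl := Set.mem_singleton_iff.1 hd
        cases s
        · refine ⟨Or.inr (self_mem_subformulas G), fun b q hq => ?_, id⟩
          cases b <;> simpa [P, c] using hq
        · refine ⟨Or.inl (self_mem_subformulas F), fun b q hq => ?_, id⟩
          cases b <;> simpa [P, c] using hq, fun s => by
        cases s
        · exact fun h => hsep h.symm
        · exact hsep⟩
    obtain ⟨I, hpI, hI⟩ := exists_generic hX hXc p
    have hF := realize_of_mem hI F true true Fin.elim0 hpI rfl
    have hG := realize_of_mem hI G false false Fin.elim0 hpI rfl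
    -- The term model lives in `Type u`, while `hFG` speaks of structures in `Type max u x`.
    let e : TermModel I ≃ ULift.{x} (TermModel I) := Equiv.ulift.symm
    let := e.inducedStructure (L := L)
    let g := e.inducedStructureEquiv (L := L)
    have hF' := (StrongHomClass.realize_boundedFormula g F).2 (hF.2 rfl)
    have hG' := (StrongHomClass.realize_boundedFormula g G).not.2 (by simpa using hG)
    have := hFG _ (g ∘ fun i => (⟦var i⟧ : TermModel I))
    have h₀ (A : L.Formula ℕ) : A.Realize (g ∘ fun i => (⟦var i⟧ : TermModel I)) ↔
        BoundedFormula.Realize A (g ∘ fun i => (⟦var i⟧ : TermModel I))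
          (g ∘ fun j => (⟦Fin.elim0 j⟧ : TermModel I)) := by
      rw [Formula.Realize, iff_eq_eq]
      exact congrArg _ (Subsingleton.elim _ _)
    exact hG' ((h₀ G).1 (this ((h₀ F).2 hF')))

end Countable

/-! ### Turning constants into variables and dropping unused function symbols -/

section Translation

variable {L : FirstOrder.Language.{u, v}} {α : Type w} {β : Type w'}

/-- The language with all relation symbols of `L` and the non-constant function symbols in `S`. -/
abbrev reduced (L : FirstOrder.Language.{u, v}) (S : Set (Σ n, L.Functions n)) :
    FirstOrder.Language.{u, v} :=
  withFuns L fun n => {f : L.Functions n // ⟨n, f⟩ ∈ S ∧ n ≠ 0}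

variable (S : Set (Σ n, L.Functions n))

/-- The inclusion of the reduced language. -/
def incl : reduced L S →ᴸ L := ⟨fun _ f => f.1, fun _ R => R⟩

open Classical in
/-- Replace variables and constants by numbered variables and drop functions outside `S`. -/
noncomputable def trTerm (e : α ⊕ L.Constants → ℕ) :
    L.Term (α ⊕ β) → (reduced L S).Term (ℕ ⊕ β)
  | var (Sum.inl a) => var (Sum.inl (e (Sum.inl a)))
  | var (Sum.inr b) => var (Sum.inr b)
  | @func _ _ 0 f _ => var (Sum.inl (e (Sum.inr f)))
  | @func _ _ (n + 1) f ts =>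
    if h : ⟨n + 1, f⟩ ∈ S ∧ n + 1 ≠ 0 then
      func (⟨f, h⟩ : (reduced L S).Functions (n + 1)) fun i => trTerm e (ts i)
    -- A junk value: meaning is preserved only for terms whose function symbols lie in `S`.
    else trTerm e (ts 0)

/-- The translation of formulas induced by `trTerm`. -/
noncomputable def trFormula (e : α ⊕ L.Constants → ℕ) {n : ℕ} (φ : L.BoundedFormula α n) :
    (reduced L S).BoundedFormula ℕ n :=
  φ.mapTermRel (g := id) (fun _ => trTerm S e) (fun _ => id) (fun _ => id)

theorem preds_trFormula (e : α ⊕ L.Constants → ℕ) {n : ℕ} (φ : L.BoundedFormula α n) :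
    preds (trFormula S e φ) = preds φ :=
  preds_mapTermRel (g := id) _ _ (fun _ _ => rfl) φ

theorem eqOccurs_trFormula (e : α ⊕ L.Constants → ℕ) {n : ℕ} (φ : L.BoundedFormula α n)
    (b : Bool) : EqOccurs b (trFormula S e φ) ↔ EqOccurs b φ :=
  eqOccurs_mapTermRel (g := id) _ _ (fun _ _ _ => Iff.rfl) b φ

/-- The free variables and constants of a term. -/
def termSupport [DecidableEq α] (t : L.Term (α ⊕ β)) : Set (α ⊕ L.Constants) :=
  {z | Sum.elim (· ∈ t.varFinsetLeft) (fun c => (⟨0, c⟩ : Σ n, L.Functions n) ∈ termFuns t) z}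

/-- The free variables and constants of a formula. -/
def support [DecidableEq α] {n : ℕ} (φ : L.BoundedFormula α n) : Set (α ⊕ L.Constants) :=
  {z | Sum.elim (· ∈ φ.freeVarFinset) (· ∈ consts φ) z}

theorem termSupport_subset_func [DecidableEq α] {n : ℕ} (f : L.Functions n)
    (ts : Fin n → L.Term (α ⊕ β)) (i : Fin n) : termSupport (ts i) ⊆ termSupport (func f ts) := by
  rintro (a | c) h
  · exact Finset.mem_biUnion.2 ⟨i, Finset.mem_univ i, h⟩
  · exact Or.inr (Set.mem_iUnion.2 ⟨i, h⟩)

theorem termSupport_subset_left [DecidableEq α] {n : ℕ} (s t : L.Term (α ⊕ Fin n)) :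
    termSupport s ⊆ support (.equal s t) := by
  rintro (a | c) h
  · exact Finset.mem_union_left _ h
  · exact Or.inl h

theorem termSupport_subset_right [DecidableEq α] {n : ℕ} (s t : L.Term (α ⊕ Fin n)) :
    termSupport t ⊆ support (.equal s t) := by
  rintro (a | c) h
  · exact Finset.mem_union_right _ h
  · exact Or.inr h

theorem termSupport_subset_rel [DecidableEq α] {n k : ℕ} (R : L.Relations k)
    (ts : Fin k → L.Term (α ⊕ Fin n)) (i : Fin k) : termSupport (ts i) ⊆ support (.rel R ts) := by
  rintro (a | c) h
  · exact Finset.mem_biUnion.2 ⟨i, Finset.mem_univ i, h⟩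
  · exact Set.mem_iUnion.2 ⟨i, h⟩

theorem support_subset_imp_left [DecidableEq α] {n : ℕ} (φ ψ : L.BoundedFormula α n) :
    support φ ⊆ support (φ.imp ψ) := by
  rintro (a | c) h
  · exact Finset.mem_union_left _ h
  · exact Or.inl h

theorem support_subset_imp_right [DecidableEq α] {n : ℕ} (φ ψ : L.BoundedFormula α n) :
    support ψ ⊆ support (φ.imp ψ) := by
  rintro (a | c) h
  · exact Finset.mem_union_right _ h
  · exact Or.inr h

theorem varFinsetLeft_trTerm [DecidableEq α] (e : α ⊕ L.Constants → ℕ) (t : L.Term (α ⊕ β)) :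
    ∀ i ∈ (trTerm S e t).varFinsetLeft, i ∈ e '' termSupport t := by
  induction t with
  | var a =>
    rcases a with a | b
    · intro i hi
      simp only [trTerm, Term.varFinsetLeft, Finset.mem_singleton] at hi
      exact ⟨Sum.inl a, by simp [termSupport], hi.symm⟩
    · simp [trTerm]
  | @func n f ts ih =>
    intro i hi
    cases n with
    | zero =>
      simp only [trTerm, Term.varFinsetLeft, Finset.mem_singleton] at hi
      exact ⟨Sum.inr f, Or.inl rfl, hi.symm⟩
    | succ n =>
      rw [trTerm] at hi
      split_ifs at hi
      · obtain ⟨j, -, hj⟩ := Finset.mem_biUnion.1 hi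
        exact Set.image_mono (termSupport_subset_func f ts j) (ih j i hj)
      · exact Set.image_mono (termSupport_subset_func f ts 0) (ih 0 i hi)

theorem freeVarFinset_trFormula [DecidableEq α] (e : α ⊕ L.Constants → ℕ) {n : ℕ}
    (φ : L.BoundedFormula α n) : ∀ i ∈ (trFormula S e φ).freeVarFinset, i ∈ e '' support φ := by
  induction φ with
  | falsum => intro i hi; exact absurd hi (Finset.notMem_empty i)
  | equal s t =>
    intro i hi
    rcases Finset.mem_union.1 hi with hi | hi
    · exact Set.image_mono (termSupport_subset_left s t) (varFinsetLeft_trTerm S e s i hi)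
    · exact Set.image_mono (termSupport_subset_right s t) (varFinsetLeft_trTerm S e t i hi)
  | rel R ts =>
    intro i hi
    obtain ⟨j, -, hj⟩ := Finset.mem_biUnion.1 hi
    exact Set.image_mono (termSupport_subset_rel R ts j) (varFinsetLeft_trTerm S e _ i hj)
  | imp φ ψ ih₁ ih₂ =>
    intro i hi
    rcases Finset.mem_union.1 hi with hi | hi
    · exact Set.image_mono (support_subset_imp_left φ ψ) (ih₁ i hi)
    · exact Set.image_mono (support_subset_imp_right φ ψ) (ih₂ i hi)
  | all φ ih => exact ih

/-- The values of variables and constants. -/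
def supportVal {M : Type*} [L.Structure M] (v : α → M) : α ⊕ L.Constants → M :=
  Sum.elim v fun c => (c : M)

variable {S}

/-- Injectivity of `e` is not needed here; it matters only when a suitable `w` has to be found. -/
theorem realize_trTerm [DecidableEq α] {M : Type*} [L.Structure M] [(reduced L S).Structure M]
    [(incl S).IsExpansionOn M] {e : α ⊕ L.Constants → ℕ} {t : L.Term (α ⊕ β)} {v : α → M}
    {w : ℕ → M} {x : β → M} (hS : termFuns t ⊆ S)
    (hw : ∀ z ∈ termSupport t, w (e z) = supportVal v z) :
    (trTerm S e t).realize (Sum.elim w x) = t.realize (Sum.elim v x) := by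
  induction t with
  | var a =>
    rcases a with a | b
    · exact hw (Sum.inl a) (by simp [termSupport])
    · rfl
  | @func n f ts ih =>
    cases n with
    | zero =>
      refine (hw (Sum.inr f) (Or.inl rfl)).trans ?_
      exact congrArg (Structure.funMap f) (Subsingleton.elim _ _)
    | succ n =>
      have hf : (⟨n + 1, f⟩ : Σ n, L.Functions n) ∈ S := hS (Or.inl rfl)
      rw [trTerm, dif_pos ⟨hf, n.succ_ne_zero⟩, Term.realize, Term.realize]
      rw [← LHom.map_onFunction (incl S)]
      refine congrArg (Structure.funMap f) (funext fun i => ih i ?_ fun z hz => ?_)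
      · exact (Set.subset_iUnion (fun i => termFuns (ts i)) i).trans
          (Set.subset_union_right.trans hS)
      · exact hw z (termSupport_subset_func f ts i hz)

theorem realize_trFormula [DecidableEq α] {M : Type*} [L.Structure M]
    [(reduced L S).Structure M] [(incl S).IsExpansionOn M] {e : α ⊕ L.Constants → ℕ} {n : ℕ}
    {φ : L.BoundedFormula α n} {v : α → M} {w : ℕ → M} {x : Fin n → M} (hS : funs φ ⊆ S)
    (hw : ∀ z ∈ support φ, w (e z) = supportVal v z) :
    (trFormula S e φ).Realize w x ↔ φ.Realize v x := by
  induction φ with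
  | falsum => rfl
  | equal s t =>
    refine iff_of_eq (congrArg₂ (· = ·) (realize_trTerm (Set.subset_union_left.trans hS) ?_)
      (realize_trTerm (Set.subset_union_right.trans hS) ?_))
    · exact fun z hz => hw z (termSupport_subset_left s t hz)
    · exact fun z hz => hw z (termSupport_subset_right s t hz)
  | rel R ts =>
    have h (i) := realize_trTerm (M := M) (x := x) (t := ts i) (v := v) (w := w) (e := e)
      ((Set.subset_iUnion (fun i => termFuns (ts i)) i).trans hS)
      fun z hz => hw z (termSupport_subset_rel R ts i hz)
    rw [trFormula, BoundedFormula.mapTermRel, BoundedFormula.Realize, BoundedFormula.Realize]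
    simp only [h]
    exact iff_of_eq (LHom.map_onRelation (incl S) R _).symm
  | imp φ ψ ih₁ ih₂ =>
    refine imp_congr (ih₁ (Set.subset_union_left.trans hS) ?_)
      (ih₂ (Set.subset_union_right.trans hS) ?_)
    · exact fun z hz => hw z (support_subset_imp_left φ ψ hz)
    · exact fun z hz => hw z (support_subset_imp_right φ ψ hz)
  | all φ ih => exact forall_congr' fun m => ih hS hw

open Classical in
/-- An expansion of a structure for the reduced language in which the constants have prescribed
values. -/
@[reducible] noncomputable def expansion (S : Set (Σ n, L.Functions n)) {M : Type*}
    [(reduced L S).Structure M] (k : L.Constants → M) (m : M) : L.Structure M where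
  funMap {n} := match n with
    | 0 => fun f _ => k f
    | n + 1 => fun f xs =>
      if h : ⟨n + 1, f⟩ ∈ S ∧ n + 1 ≠ 0 then
        Structure.funMap (L := reduced L S) ⟨f, h⟩ xs
      else m
  RelMap R xs := Structure.RelMap (L := reduced L S) R xs

theorem expansion_isExpansionOn {M : Type*} [(reduced L S).Structure M] (k : L.Constants → M)
    (m : M) : @LHom.IsExpansionOn _ _ (incl S) M _ (expansion S k m) := by
  let := expansion S k m
  refine ⟨fun {n} f xs => ?_, fun _ _ => rfl⟩
  cases n with
  | zero => exact absurd rfl f.2.2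
  | succ n => exact dif_pos f.2

theorem preds_onFormula {n : ℕ} (φ : (reduced L S).BoundedFormula α n) :
    preds ((incl S).onBoundedFormula φ) = preds φ := by
  induction φ with
  | falsum | equal | rel => rfl
  | imp _ _ ih₁ ih₂ => rw [LHom.onBoundedFormula, preds, ih₁, ih₂, preds]
  | all _ ih => rw [LHom.onBoundedFormula, preds, ih, preds]

theorem eqOccurs_onFormula {n : ℕ} (φ : (reduced L S).BoundedFormula α n) (b : Bool) :
    EqOccurs b ((incl S).onBoundedFormula φ) ↔ EqOccurs b φ := by
  induction φ generalizing b with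
  | falsum | equal | rel => rfl
  | imp _ _ ih₁ ih₂ => rw [LHom.onBoundedFormula, EqOccurs, ih₁, ih₂, EqOccurs]
  | all _ ih => rw [LHom.onBoundedFormula, EqOccurs, ih, EqOccurs]

theorem termFuns_onTerm (t : (reduced L S).Term α) :
    termFuns ((incl S).onTerm t) ⊆ {f | f ∈ S ∧ f.1 ≠ 0} := by
  induction t with
  | var => exact Set.empty_subset _
  | func f ts ih => exact Set.union_subset (Set.singleton_subset_iff.2 f.2) (Set.iUnion_subset ih)

theorem funs_onFormula {n : ℕ} (φ : (reduced L S).BoundedFormula α n) :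
    funs ((incl S).onBoundedFormula φ) ⊆ {f | f ∈ S ∧ f.1 ≠ 0} := by
  induction φ with
  | falsum => exact Set.empty_subset _
  | equal s t => exact Set.union_subset (termFuns_onTerm s) (termFuns_onTerm t)
  | rel R ts => exact Set.iUnion_subset fun i => termFuns_onTerm (ts i)
  | imp _ _ ih₁ ih₂ => exact Set.union_subset ih₁ ih₂
  | all _ ih => exact ih

theorem termFuns_relabel (t : L.Term α) (g : α → β) : termFuns (t.relabel g) = termFuns t := by
  induction t with
  | var => rfl
  | func f ts ih => simp only [Term.relabel, termFuns, ih]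

theorem varFinsetLeft_relabel_inl [DecidableEq α] (t : L.Term α) :
    (t.relabel (Sum.inl : α → α ⊕ β)).varFinsetLeft = t.varFinset := by
  induction t with
  | var => rfl
  | func f ts ih => simp only [Term.relabel, Term.varFinsetLeft, ih, Term.varFinset]

theorem termFuns_subst (t : L.Term α) (d : α → L.Term β) :
    termFuns (t.subst d) ⊆ termFuns t ∪ ⋃ a, termFuns (d a) := by
  induction t with
  | var a => exact (Set.subset_iUnion (fun a => termFuns (d a)) a).trans Set.subset_union_right
  | func f ts ih =>
    refine Set.union_subset (fun _ h => Or.inl (Or.inl h)) (Set.iUnion_subset fun i => ?_)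
    refine (ih i).trans (Set.union_subset_union_left _ ?_)
    exact (Set.subset_iUnion (fun i => termFuns (ts i)) i).trans Set.subset_union_right

theorem termFuns_subst_lift {γ : Type*} (t : L.Term (α ⊕ γ)) (d : α → L.Term β) :
    termFuns (t.subst (Sum.elim (Term.relabel Sum.inl ∘ d) (var ∘ Sum.inr)) : L.Term (β ⊕ γ)) ⊆
      termFuns t ∪ ⋃ a, termFuns (d a) := by
  refine (termFuns_subst t _).trans (Set.union_subset_union_right _ (Set.iUnion_subset ?_))
  rintro (a | c)
  · simp only [Sum.elim_inl, Function.comp, termFuns_relabel]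
    exact Set.subset_iUnion (fun a => termFuns (d a)) a
  · exact Set.empty_subset _

theorem funs_subst {n : ℕ} (φ : L.BoundedFormula α n) (d : α → L.Term β) :
    funs (φ.subst d) ⊆ funs φ ∪ ⋃ a, termFuns (d a) := by
  induction φ with
  | falsum => exact Set.empty_subset _
  | equal s t =>
    exact Set.union_subset
      ((termFuns_subst_lift s d).trans (Set.union_subset_union_left _ Set.subset_union_left))
      ((termFuns_subst_lift t d).trans (Set.union_subset_union_left _ Set.subset_union_right))
  | rel R ts =>
    exact Set.iUnion_subset fun i => (termFuns_subst_lift (ts i) d).trans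
      (Set.union_subset_union_left _ (Set.subset_iUnion (fun i => termFuns (ts i)) i))
  | imp _ _ ih₁ ih₂ =>
    exact Set.union_subset
      (ih₁.trans (Set.union_subset_union_left _ Set.subset_union_left))
      (ih₂.trans (Set.union_subset_union_left _ Set.subset_union_right))
  | all _ ih => exact ih

theorem varFinsetLeft_subst_lift [DecidableEq β] {γ : Type*} (t : L.Term (α ⊕ γ))
    (d : α → L.Term β) {b : β}
    (hb : b ∈ (t.subst (Sum.elim (Term.relabel Sum.inl ∘ d) (var ∘ Sum.inr)) :
      L.Term (β ⊕ γ)).varFinsetLeft) : ∃ a, b ∈ (d a).varFinset := by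
  induction t with
  | var a =>
    rcases a with a | c
    · exact ⟨a, by simpa [varFinsetLeft_relabel_inl] using hb⟩
    · simp at hb
  | func f ts ih =>
    obtain ⟨i, -, hi⟩ := Finset.mem_biUnion.1 hb
    exact ih i hi

theorem freeVarFinset_subst [DecidableEq β] {n : ℕ} (φ : L.BoundedFormula α n)
    (d : α → L.Term β) {b : β} (hb : b ∈ (φ.subst d).freeVarFinset) :
    ∃ a, b ∈ (d a).varFinset := by
  induction φ with
  | falsum => exact absurd hb (Finset.notMem_empty b)
  | equal s t =>
    exact (Finset.mem_union.1 hb).elim (varFinsetLeft_subst_lift s d)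
      (varFinsetLeft_subst_lift t d)
  | rel R ts =>
    obtain ⟨i, -, hi⟩ := Finset.mem_biUnion.1 hb
    exact varFinsetLeft_subst_lift (ts i) d hi
  | imp _ _ ih₁ ih₂ => exact (Finset.mem_union.1 hb).elim ih₁ ih₂
  | all _ ih => exact ih hb

theorem finite_termFuns (t : L.Term α) : (termFuns t).Finite := by
  induction t with
  | var => exact Set.finite_empty
  | func f ts ih => exact (Set.finite_singleton _).union (Set.finite_iUnion ih)

theorem finite_funs {n : ℕ} (φ : L.BoundedFormula α n) : (funs φ).Finite := by
  induction φ with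
  | falsum => exact Set.finite_empty
  | equal s t => exact (finite_termFuns s).union (finite_termFuns t)
  | rel R ts => exact Set.finite_iUnion fun i => finite_termFuns (ts i)
  | imp _ _ ih₁ ih₂ => exact ih₁.union ih₂
  | all _ ih => exact ih

theorem finite_support [DecidableEq α] {n : ℕ} (φ : L.BoundedFormula α n) :
    (support φ).Finite := by
  have h : (consts φ).Finite :=
    (finite_funs φ).preimage fun c _ c' _ h => eq_of_heq (Sigma.mk.inj h).2
  refine ((φ.freeVarFinset.finite_toSet.image Sum.inl).union (h.image Sum.inr)).subset ?_
  rintro (a | c) hz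
  · exact Or.inl ⟨a, hz, rfl⟩
  · exact Or.inr ⟨c, hz, rfl⟩

end Translation

/-! ### Eliminating unshared variables -/

section Quantification

variable {L : FirstOrder.Language.{u, v}}

/-- The variables of an interpolant that are not shared can be quantified away. -/
theorem exists_interpolant_shared (F G H : L.Formula ℕ)
    (hFH : ∀ (M : Type x) [L.Structure M] (v : ℕ → M), F.Realize v → H.Realize v)
    (hHG : ∀ (M : Type x) [L.Structure M] (v : ℕ → M), H.Realize v → G.Realize v) :
    ∃ K : L.Formula {i // i ∈ F.freeVarFinset ∧ i ∈ G.freeVarFinset},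
      (∀ (M : Type x) [L.Structure M] (v : ℕ → M), F.Realize v → K.Realize (fun i => v i)) ∧
      (∀ (M : Type x) [L.Structure M] (v : ℕ → M), K.Realize (fun i => v i) → G.Realize v) ∧
      preds K = preds H ∧ ∀ b, EqOccurs b K ↔ EqOccurs b H := by
  let O := {i : H.freeVarFinset // i.1 ∉ F.freeVarFinset}
  let E := {i : H.freeVarFinset // i.1 ∉ G.freeVarFinset}
  -- A variable free in neither formula is sent to `O`; its copy in `E` is then quantified
  -- vacuously.
  let f : H.freeVarFinset → ({i // i ∈ F.freeVarFinset ∧ i ∈ G.freeVarFinset} ⊕ O) ⊕ E :=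
    fun i => if h : i.1 ∈ F.freeVarFinset then
      if h' : i.1 ∈ G.freeVarFinset then .inl (.inl ⟨i, h, h'⟩) else .inr ⟨i, h'⟩
    else .inl (.inr ⟨i, h⟩)
  -- Variables not free in `F` may be universally quantified in a consequence of `F`; those not free
  -- in `G` may be existentially quantified in a premise of `G`.
  refine ⟨Formula.iAlls O (Formula.iExs E (H.restrictFreeVar f)), fun M _ v hF => ?_,
    fun M _ v hK => ?_, by simp, by simp⟩
  · rw [Formula.realize_iAlls]
    intro o
    rw [Formula.realize_iExs]
    let w : ℕ → M := fun i =>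
      if h : i ∈ H.freeVarFinset ∧ i ∉ F.freeVarFinset then o ⟨⟨i, h.1⟩, h.2⟩ else v i
    have hw : F.Realize w := (realize_congr fun i hi => by simp [w, hi]).1 hF
    refine ⟨fun i => w i.1, (BoundedFormula.realize_restrictFreeVar w fun i => ?_).2 (hFH M w hw)⟩
    by_cases h : i.1 ∈ F.freeVarFinset
    · by_cases h' : i.1 ∈ G.freeVarFinset <;> simp [f, h, h', w]
    · simp [f, h, w]
  · have := Formula.realize_iExs.1 (Formula.realize_iAlls.1 hK fun i => v i.1)
    obtain ⟨ε, hε⟩ := this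
    let w : ℕ → M := fun i =>
      if h : (i ∈ H.freeVarFinset ∧ i ∉ G.freeVarFinset) ∧ i ∈ F.freeVarFinset then
        ε ⟨⟨i, h.1.1⟩, h.1.2⟩ else v i
    have hw : H.Realize w := (BoundedFormula.realize_restrictFreeVar w fun i => by
      by_cases h : i.1 ∈ F.freeVarFinset
      · by_cases h' : i.1 ∈ G.freeVarFinset <;> simp [f, h, h', w]
      · simp [f, h, w]).1 hε
    exact (realize_congr fun i hi => by simp [w, hi]).1 (hHG M w hw)

end Quantification

/-! ### The interpolation theorem for arbitrary languages -/

section Interpolants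

variable {L : FirstOrder.Language.{u, v}} {α : Type w}

theorem imp_empty_iff {F G : L.Formula α} : (∅ : L.Theory).Imp F G ↔
    ∀ (M : Type max u v w) [L.Structure M] [Nonempty M] (v : α → M),
      F.Realize v → G.Realize v := by
  refine ⟨fun h M _ _ v hF => ?_, fun h M v xs => ?_⟩
  · exact BoundedFormula.realize_imp.1 (h (Theory.ModelType.of ∅ M) v default) hF
  · rw [Subsingleton.elim xs default]
    exact BoundedFormula.realize_imp.2 (h M v)

theorem realize_supportTerm {M : Type*} [L.Structure M] (v : α → M) (z : α ⊕ L.Constants) :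
    (Sum.elim var Constants.term z : L.Term α).realize v = supportVal v z := by
  rcases z with a | c
  · rfl
  · exact Term.realize_constants

/-- An interpolant of the translations, restricted to shared numbered variables, is pulled back by
substituting for each number the variable or constant that it encodes. -/
theorem exists_interpolant [DecidableEq α] (F G : L.Formula α)
    (hFG : (∅ : L.Theory).Imp F G) :
    ∃ H : L.Formula α, ((∅ : L.Theory).Imp F H ∧ (∅ : L.Theory).Imp H G) ∧
      (preds H ⊆ preds F ∩ preds G ∧
        H.freeVarFinset ⊆ F.freeVarFinset ∩ G.freeVarFinset ∧
        consts H ⊆ consts F ∩ consts G) ∧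
      funs H ⊆ funs F ∪ funs G ∧
      ((EqOccurs true H → EqOccurs true F) ∧ (EqOccurs false H → EqOccurs false G)) := by
  simp only [imp_empty_iff] at hFG ⊢
  let S := funs F ∪ funs G
  have hS : S.Finite := (finite_funs F).union (finite_funs G)
  have : Countable (Σ n, (reduced L S).Functions n) := by
    have := hS.countable.to_subtype
    refine Function.Injective.countable (f := fun f => (⟨⟨f.1, f.2.1⟩, f.2.2.1⟩ : S)) ?_
    rintro ⟨n, f, hf⟩ ⟨m, g, hg⟩ h
    simp only [Subtype.mk.injEq, Sigma.mk.injEq] at h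
    obtain ⟨rfl, h⟩ := h
    obtain rfl := eq_of_heq h
    rfl
  -- Injectivity on the two supports ensures that a shared number encodes a shared variable or
  -- constant.
  obtain ⟨e, he⟩ := Set.countable_iff_exists_injOn.1
    ((finite_support F).union (finite_support G)).countable
  have real_iff {M : Type max u v w} [L.Structure M] [(reduced L S).Structure M]
      [(incl S).IsExpansionOn M] {v : α → M} {w : ℕ → M}
      (hw : ∀ z ∈ support F ∪ support G, w (e z) = supportVal v z) :
      (Formula.Realize (trFormula S e F) w ↔ F.Realize v) ∧
        (Formula.Realize (trFormula S e G) w ↔ G.Realize v) :=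
    ⟨realize_trFormula Set.subset_union_left fun z hz => hw z (Or.inl hz),
      realize_trFormula Set.subset_union_right fun z hz => hw z (Or.inr hz)⟩
  obtain ⟨H₀, h₁, h₂, h₃, h₄⟩ := exists_interpolant_of_countable.{u, v, max v w}
    (trFormula S e F) (trFormula S e G) fun M _ w hF => by
      -- Constants are interpreted by the values of the variables encoding them; `w 0` is an
      -- arbitrary default for function symbols outside `S`.
      let := expansion S (fun c => w (e (Sum.inr c))) (w 0)
      have := expansion_isExpansionOn (S := S) (fun c => w (e (Sum.inr c))) (w 0)
      have h := real_iff (v := fun a => w (e (Sum.inl a))) (w := w)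
        (by rintro (a | c) - <;> rfl)
      have : Nonempty M := ⟨w 0⟩
      exact h.2.2 (hFG M _ (h.1.1 hF))
  obtain ⟨K, k₁, k₂, k₃, k₄⟩ := exists_interpolant_shared _ _ H₀ h₁ h₂
  have hz (i : {i // i ∈ (trFormula S e F).freeVarFinset ∧ i ∈ (trFormula S e G).freeVarFinset}) :
      ∃ z, z ∈ support F ∧ z ∈ support G ∧ e z = i := by
    obtain ⟨z, hz, hzi⟩ := freeVarFinset_trFormula S e F i i.2.1
    obtain ⟨z', hz', hzi'⟩ := freeVarFinset_trFormula S e G i i.2.2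
    obtain rfl := he (Or.inl hz) (Or.inr hz') (hzi.trans hzi'.symm)
    exact ⟨z, hz, hz', hzi⟩
  choose z hzF hzG hze using hz
  let d := fun i => (Sum.elim var Constants.term (z i) : L.Term α)
  have real_K {M : Type max u v w} [L.Structure M] [(reduced L S).Structure M]
      [(incl S).IsExpansionOn M] {v : α → M} {w : ℕ → M}
      (hw : ∀ z ∈ support F ∪ support G, w (e z) = supportVal v z) :
      Formula.Realize (((incl S).onFormula K).subst d) v ↔ K.Realize fun i => w i := by
    rw [Formula.Realize, BoundedFormula.realize_subst, ← Formula.Realize, LHom.realize_onFormula]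
    refine iff_of_eq (congrArg _ (funext fun i => ?_))
    rw [realize_supportTerm, ← hw _ (Or.inl (hzF i)), hze]
  have exists_w {M : Type max u v w} [L.Structure M] [Nonempty M] (v : α → M) :
      ∃ w : ℕ → M, ∀ z ∈ support F ∪ support G, w (e z) = supportVal v z := by
    classical
    refine ⟨fun i => if h : ∃ z ∈ support F ∪ support G, e z = i then supportVal v h.choose
      -- Nonemptiness supplies values for numbers that encode nothing; there may be no variables or
      -- constants at all.
      else Classical.arbitrary M, fun z hz => ?_⟩
    have h : ∃ z' ∈ support F ∪ support G, e z' = e z := ⟨z, hz, rfl⟩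
    exact (dif_pos h).trans (congrArg _ (he h.choose_spec.1 hz h.choose_spec.2))
  have termFuns_d (i) (f : Σ n, L.Functions n) (hf : f ∈ termFuns (d i)) :
      ∃ c, f = ⟨0, c⟩ ∧ c ∈ consts F ∧ c ∈ consts G := by
    have hF := hzF i
    have hG := hzG i
    simp only [d] at hf
    generalize z i = y at hf hF hG
    rcases y with a | c
    · exact hf.elim
    · refine ⟨c, ?_, hF, hG⟩
      rcases hf with hf | hf
      · exact hf
      · obtain ⟨j, -⟩ := Set.mem_iUnion.1 hf
        exact j.elim0
  have funs_H {f : Σ n, L.Functions n} (hf : f ∈ funs (((incl S).onFormula K).subst d)) :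
      (f ∈ S ∧ f.1 ≠ 0) ∨ ∃ c, f = ⟨0, c⟩ ∧ c ∈ consts F ∧ c ∈ consts G := by
    rcases funs_subst _ _ hf with hf | hf
    · exact Or.inl (funs_onFormula _ hf)
    · obtain ⟨i, hi⟩ := Set.mem_iUnion.1 hf
      exact Or.inr (termFuns_d i f hi)
  refine ⟨((incl S).onFormula K).subst d, ⟨fun M _ _ v hF => ?_, fun M _ _ v hH => ?_⟩,
    ⟨?_, fun a ha => ?_, fun c hc => ?_⟩, fun f hf => ?_, ?_, ?_⟩
  · let := (incl S).reduct M
    obtain ⟨w, hw⟩ := exists_w v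
    exact (real_K hw).2 (k₁ M w ((real_iff hw).1.2 hF))
  · let := (incl S).reduct M
    obtain ⟨w, hw⟩ := exists_w v
    exact (real_iff hw).2.1 (k₂ M w ((real_K hw).1 hH))
  · rw [preds_subst, LHom.onFormula, preds_onFormula, k₃]
    rwa [preds_trFormula, preds_trFormula] at h₃
  · obtain ⟨i, hi⟩ := freeVarFinset_subst _ _ ha
    have hF := hzF i
    have hG := hzG i
    simp only [d] at hi
    generalize z i = y at hi hF hG
    rcases y with b | c
    · obtain rfl := Finset.mem_singleton.1 hi
      exact Finset.mem_inter.2 ⟨hF, hG⟩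
    · simp [Constants.term] at hi
  · rcases funs_H hc with h | ⟨c', h, hF, hG⟩
    · exact absurd rfl h.2
    · obtain rfl := eq_of_heq (Sigma.mk.inj h).2
      exact ⟨hF, hG⟩
  · rcases funs_H hf with h | ⟨c, rfl, hF, hG⟩
    · exact h.1
    · exact Or.inl hF
  · rw [eqOccurs_subst, LHom.onFormula, eqOccurs_onFormula, k₄,
      ← eqOccurs_trFormula S e F]
    exact h₄.1
  · rw [eqOccurs_subst, LHom.onFormula, eqOccurs_onFormula, k₄,
      ← eqOccurs_trFormula S e G]
    exact h₄.2

end Interpolants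

end Interpolation

theorem mainTheorem3 {L : FirstOrder.Language} {α : Type*} [DecidableEq α]
    (F G : L.Formula α) (hFG : (∅ : L.Theory).Imp F G) :
    ∃ H : L.Formula α,
      ((∅ : L.Theory).Imp F H ∧ (∅ : L.Theory).Imp H G) ∧
      (Interpolation.preds H ⊆ Interpolation.preds F ∩ Interpolation.preds G ∧
        H.freeVarFinset ⊆ F.freeVarFinset ∩ G.freeVarFinset ∧
        Interpolation.consts H ⊆ Interpolation.consts F ∩ Interpolation.consts G) ∧
      Interpolation.funs H ⊆ Interpolation.funs F ∪ Interpolation.funs G ∧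
      ((Interpolation.EqOccurs true H → Interpolation.EqOccurs true F) ∧
        (Interpolation.EqOccurs false H → Interpolation.EqOccurs false G)) :=
  Interpolation.exists_interpolant F G hFG
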